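/- Notation: for $a\in\mathbb R^3$, $a^\times$ is the skew-symmetric matrix with $a^\times b=a\times b$. For $q=(q_v,q_4)\in\mathbb R^3\times\mathbb R$ put $$A(q)=(q_4^2-q_v^Tq_v)I+2q_vq_v^T-2q_4q_v^\times,\qquad W(q)=\frac12\begin{bmatrix}q_4I+q_v^\times\\-q_v^T\end{bmatrix},\qquad \bar q=(0,0,0,1)^T .$$ Geomagnetic field: let $r^i(t)\in\mathbb R^3$ be the position, in inertial coordinates, on a circular orbit of radius $R>0$ with orbital rate $n$, phase $\phi_0$, inclination $incl$ and right ascension of the ascending node $\Omega$, that is $$r^i(t)=R_3(\Omega)R_1(incl)\,(R\cos(nt+\phi_0),\,R\sin(nt+\phi_0),\,0)^T,$$ where $R_j(\theta)$ is the rotation by the angle $\theta$ about the $j$-th coordinate axis. Let $\hat r^i=r^i/\|r^i\|$, let $\hat m^i(t)=(\sin\theta_m\cos(\omega_et+\alpha_0),\ \sin\theta_m\sin(\omega_et+\alpha_0),\ \cos\theta_m)^T$, and let $$B^i(t)=\frac{\mu_m}{\|r^i(t)\|^3}\left[3(\hat m^i(t)^T\hat r^i(t))\,\hat r^i(t)-\hat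 m^i(t)\right],\qquad \Gamma^i(t)=B^i(t)^\times(B^i(t)^\times)^T,$$ with arbitrary real parameters $n,\phi_0,incl,\Omega,\mu_m,\theta_m,\omega_e,\alpha_0$. Theorem. Let $0<J_{min}\le J_{max}$, $k_1>0$, $k_2>0$, $\alpha>0$ and $\lambda>0$. Then the average $\Gamma^i_{av}=\lim_{T\to\infty}\frac1T\int_0^T\Gamma^i(\tau)\,d\tau$ exists, and if it is positive definite, then there exists $\epsilon^*>0$, the same for all admissible inertia matrices, such that for every $0<\epsilon<\epsilon^*$ and every symmetric $J\in\mathbb R^{3\times3}$ with $J_{min}\le\lambda_{min}(J)\le\lambda_{max}(J)\le J_{max}$, the point $(q,\omega,\delta)=\left(\bar q,0,\frac1{\epsilon\lambda}\bar q\right)$ is a locally exponentially stable equilibrium of the closed-loop system $$\dot q=W(q)\omega,\qquad J\dot\omega=-\omega^\times J\omega+A(q)\Gamma^i(t)A(q)^Tu,\qquad \dot\delta=\alpha(q-\epsilon\lambda\delta),$$ $$u=-\epsilon^2\left(k_1q_v+k_2\alpha\lambda W(q)^T(q-\epsilon\lambda\delta)\right)$$ on the state space $\{(q,\omega,\delta)\in\mathbb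 R^4\times\mathbb R^3\times\mathbb R^4:\|q\|=1\}$. Here an equilibrium $x_e$ is locally exponentially stable if there are $c,K,r>0$, independent of the initial time, such that for every $t_0\ge0$ and every state $x_0$ with $\|x_0-x_e\|<c$ there is a solution with $x(t_0)=x_0$ on $[t_0,\infty)$, and every solution with $x(t_0)=x_0$ satisfies $\|x(t)-x_e\|\le K\|x_0-x_e\|e^{-r(t-t_0)}$ for all $t\ge t_0$ at which it is defined. -/

import Mathlib

open Filter Topology
open scoped Matrix

noncomputable section

namespace MagneticAttitude

/-! ### Attitude kinematics -/

/-- The skew-symmetric matrix `a^×`, so that `a^× b = a × b`. -/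
def skew (a : Fin 3 → ℝ) : Matrix (Fin 3) (Fin 3) ℝ :=
  !![    0, -a 2,  a 1;
       a 2,    0, -a 0;
      -a 1,  a 0,    0]

/-- The vector part `q_v = (q₁, q₂, q₃)` of `q = (q₁, q₂, q₃, q₄)` (indices start at `0` here,
so that the scalar part `q₄` is `q 3`). -/
def vecPart (q : Fin 4 → ℝ) : Fin 3 → ℝ := ![q 0, q 1, q 2]

/-- The attitude matrix `A(q) = (q₄² - q_vᵀ q_v) I + 2 q_v q_vᵀ - 2 q₄ q_v^×`. -/
def attitude (q : Fin 4 → ℝ) : Matrix (Fin 3) (Fin 3) ℝ :=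
  (q 3 ^ 2 - vecPart q ⬝ᵥ vecPart q) • (1 : Matrix (Fin 3) (Fin 3) ℝ)
    + (2 : ℝ) • Matrix.vecMulVec (vecPart q) (vecPart q) - (2 * q 3) • skew (vecPart q)

/-- The `4 × 3` matrix `W(q)`, one half of the block column with blocks `q₄ I + q_v^×`
and `-q_vᵀ`. -/
def kinMatrix (q : Fin 4 → ℝ) : Matrix (Fin 4) (Fin 3) ℝ :=
  (1 / 2 : ℝ) •
    !![ q 3, -q 2,  q 1;
        q 2,  q 3, -q 0;
       -q 1,  q 0,  q 3;
       -q 0, -q 1, -q 2]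

/-- The target quaternion `q̄ = (0, 0, 0, 1)`. -/
def qbar : EuclideanSpace ℝ (Fin 4) := !₂[0, 0, 0, 1]

/-! ### The geomagnetic field along the orbit -/

/-- Parameters of a circular orbit and of the tilted rotating magnetic dipole of the Earth
(all angles in radians). -/
structure DipoleOrbit where
  /-- radius of the orbit -/
  R : ℝ
  /-- orbital rate -/
  n : ℝ
  /-- initial phase -/
  phi0 : ℝ
  /-- inclination of the orbit -/
  incl : ℝ
  /-- right ascension of the ascending node -/
  Omega : ℝ
  /-- total dipole strength -/
  mu : ℝ
  /-- coelevation of the dipole -/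
  theta : ℝ
  /-- rotation rate of the Earth -/
  omegaE : ℝ
  /-- right ascension of the dipole at time `0` -/
  alpha0 : ℝ
  R_pos : 0 < R

namespace DipoleOrbit

variable (o : DipoleOrbit)

/-- The matrix that takes coordinates in the orbital plane (first axis towards the ascending node)
to inertial coordinates: a rotation by `incl` about the first axis, then by `Omega` about the
third axis. -/
def orbitRotation : Matrix (Fin 3) (Fin 3) ℝ :=
  !![Real.cos o.Omega, -Real.sin o.Omega, 0;
     Real.sin o.Omega,  Real.cos o.Omega, 0;
     0,                 0,                1] *
  !![1, 0,               0;
     0, Real.cos o.incl, -Real.sin o.incl;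
     0, Real.sin o.incl,  Real.cos o.incl]

/-- The position `r^i(t)` of the spacecraft in inertial coordinates. -/
def position (t : ℝ) : EuclideanSpace ℝ (Fin 3) :=
  WithLp.toLp 2 (o.orbitRotation *ᵥ
    ![o.R * Real.cos (o.n * t + o.phi0), o.R * Real.sin (o.n * t + o.phi0), 0])

/-- The direction `r̂^i(t)` of the position vector. -/
def positionDir (t : ℝ) : EuclideanSpace ℝ (Fin 3) :=
  ‖o.position t‖⁻¹ • o.position t

/-- The direction `m̂^i(t)` of the magnetic dipole of the Earth. -/
def dipoleDir (t : ℝ) : EuclideanSpace ℝ (Fin 3) :=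
  !₂[Real.sin o.theta * Real.cos (o.omegaE * t + o.alpha0),
     Real.sin o.theta * Real.sin (o.omegaE * t + o.alpha0),
     Real.cos o.theta]

/-- The geomagnetic field `B^i(t)` at the spacecraft, in inertial coordinates (dipole model). -/
def field (t : ℝ) : EuclideanSpace ℝ (Fin 3) :=
  (o.mu / ‖o.position t‖ ^ 3) •
    ((3 * inner ℝ (o.dipoleDir t) (o.positionDir t)) • o.positionDir t - o.dipoleDir t)

/-- `Γ^i(t) = B^i(t)^× (B^i(t)^×)ᵀ`. -/
def Gamma (t : ℝ) : Matrix (Fin 3) (Fin 3) ℝ :=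
  skew (o.field t) * (skew (o.field t))ᵀ

end DipoleOrbit

/-- The matrix `Gav` is the time average `lim_{T → ∞} (1/T) ∫₀ᵀ G(τ) dτ` of `G`. -/
def HasTimeAverage (G : ℝ → Matrix (Fin 3) (Fin 3) ℝ) (Gav : Matrix (Fin 3) (Fin 3) ℝ) : Prop :=
  Tendsto (fun T : ℝ => Matrix.of fun i j => (1 / T) * ∫ τ in (0 : ℝ)..T, G τ i j) atTop (𝓝 Gav)

/-! ### The uncertain inertia matrix -/

/-- `J` is a symmetric matrix all of whose eigenvalues lie in `[Jmin, Jmax]`. -/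
def AdmissibleInertia (Jmin Jmax : ℝ) (J : Matrix (Fin 3) (Fin 3) ℝ) : Prop :=
  ∃ hJ : J.IsHermitian, ∀ i, Jmin ≤ hJ.eigenvalues i ∧ hJ.eigenvalues i ≤ Jmax

/-! ### The closed loop -/

/-- Triples `(q, ω, δ)`. -/
abbrev State : Type :=
  EuclideanSpace ℝ (Fin 4) × EuclideanSpace ℝ (Fin 3) × EuclideanSpace ℝ (Fin 4)

/-- The state space `𝕊³ × ℝ³ × ℝ⁴`: the states whose quaternion has norm one. -/
def stateSpace : Set State := {x | ‖x.1‖ = 1}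

/-- The control `u = -ε² (k₁ q_v + k₂ α λ W(q)ᵀ (q - ε λ δ))`. -/
def controlLaw (k₁ k₂ α lam ε : ℝ) (q δ : Fin 4 → ℝ) : Fin 3 → ℝ :=
  -(ε ^ 2 • (k₁ • vecPart q + (k₂ * α * lam) • ((kinMatrix q)ᵀ *ᵥ (q - (ε * lam) • δ))))

/-- The right-hand side of the closed loop
`q̇ = W(q) ω`, `J ω̇ = -ω^× J ω + A(q) Γ(t) A(q)ᵀ u`, `δ̇ = α (q - ε λ δ)`,
solved for the derivatives (the matrix `J` is invertible wherever this is used). -/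
def closedLoop (J : Matrix (Fin 3) (Fin 3) ℝ) (Γ : ℝ → Matrix (Fin 3) (Fin 3) ℝ)
    (k₁ k₂ α lam ε : ℝ) (t : ℝ) (x : State) : State :=
  let q : Fin 4 → ℝ := x.1
  let ω : Fin 3 → ℝ := x.2.1
  let δ : Fin 4 → ℝ := x.2.2
  (WithLp.toLp 2 (kinMatrix q *ᵥ ω),
   WithLp.toLp 2 (J⁻¹ *ᵥ (-(skew ω *ᵥ (J *ᵥ ω))
      + (attitude q * Γ t * (attitude q)ᵀ) *ᵥ controlLaw k₁ k₂ α lam ε q δ)),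
   WithLp.toLp 2 (α • (q - (ε * lam) • δ)))

/-! ### Local exponential stability -/

/-- `γ` is a solution of `ẋ = f(t, x)` on the time set `I` with values in the state space `X`. -/
def IsSolutionIn {E : Type*} [NormedAddCommGroup E] [NormedSpace ℝ E]
    (f : ℝ → E → E) (X : Set E) (γ : ℝ → E) (I : Set ℝ) : Prop :=
  IsIntegralCurveOn γ f I ∧ ∀ t ∈ I, γ t ∈ X

/-- The point `xe` is a locally exponentially stable equilibrium of the time-varying system
`ẋ = f(t, x)`, `t ≥ 0`, on the state space `X`: it is an equilibrium, and there are `c, K, r > 0`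
that do not depend on the initial time `t₀ ≥ 0`, such that from every initial state
`x₀ ∈ X` with `‖x₀ - xe‖ < c` there is a solution for all times `t ≥ t₀`, and every solution,
on whatever interval `[t₀, t₁]` it lives, satisfies
`‖x(t) - xe‖ ≤ K ‖x₀ - xe‖ exp (-r (t - t₀))`. -/
def IsLocallyExpStable {E : Type*} [NormedAddCommGroup E] [NormedSpace ℝ E]
    (f : ℝ → E → E) (X : Set E) (xe : E) : Prop :=
  xe ∈ X ∧ (∀ t, 0 ≤ t → f t xe = 0) ∧
  ∃ c > 0, ∃ K > 0, ∃ r > 0, ∀ t₀ : ℝ, 0 ≤ t₀ → ∀ x₀ ∈ X, ‖x₀ - xe‖ < c →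
    (∃ γ : ℝ → E, γ t₀ = x₀ ∧ IsSolutionIn f X γ (Set.Ici t₀)) ∧
    ∀ (γ : ℝ → E) (t₁ : ℝ), γ t₀ = x₀ → IsSolutionIn f X γ (Set.Icc t₀ t₁) →
      ∀ t ∈ Set.Icc t₀ t₁, ‖γ t - xe‖ ≤ K * ‖x₀ - xe‖ * Real.exp (-r * (t - t₀))

end MagneticAttitude

end

open MagneticAttitude

/-! Put p = q_v, h = Jω/ε, s = vector part of q − ελδ, e = δ₄ − 1/(ελ), c = k₂αλ/2 and K = J⁻¹. Up
to terms that are o(distance to the equilibrium) uniformly in time, the closed loop is the slow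
linear system p' = εKh/2, h' = −εΓ(t)(k₁p + cs), s' = ε(Kh/2 − αλs), e' = −εαλe. The scalar part of
q needs no coordinate of its own: on the unit sphere q₄ − 1 is quadratic in the distance to q̄.

If Γ is replaced by its average G > 0, the energy ⟨h,Kh⟩/2 + k₁⟨p,Gp⟩ + c⟨s,Gs⟩ has slow-time
derivative −2cαλ⟨s,Gs⟩, so only s is damped. The cross terms κ⟨h,p⟩ − 2κ⟨h,s⟩ with small κ spread
the damping to p and h (`lyapDeriv_averaged`, `exists_lyapFun_bounds`). All constants see K only
through the bounds 1/Jmax and 1/Jmin, which is why ε* can serve every admissible J.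

The orbit radius is constant, so the entries of Γ are trigonometric polynomials and Γ − G has a
bounded primitive H (`exists_hasTimeAverage_Gamma`, `exists_bounded_primitive`). Passing from h to h
+ εH(k₁p + cs) replaces Γ by G at the price of errors of order ε², which a decay of order ε absorbs
once ε is small (`exists_lyapFun_bounds_perturbed`).

Adding e² gives the time-varying function `closedLoopLyap`. The nonlinear remainders are absorbed in
a small ball, which may depend on J and ε. `isLocallyExpStable_of_lyapunov` then concludes; it also
yields global solutions, by cutting the field off and showing that the resulting curves never leave
the region where the cutoff equals one. -/

noncomputable section

/-! ### Global solutions and Lyapunov's theorem on a level set. -/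

section ODE

variable {E : Type*} [NormedAddCommGroup E] [NormedSpace ℝ E]

/-- A time-varying vector field that is bounded, continuous in time and Lipschitz in space has an
integral curve on every half-line `[t₀, ∞)`. -/
theorem exists_isIntegralCurveOn_Ici_of_bounded_lipschitz [CompleteSpace E] {f : ℝ → E → E}
    {K L : NNReal} (hlip : ∀ t, LipschitzWith K (f t)) (hcont : ∀ x, Continuous fun t => f t x)
    (hL : ∀ t x, ‖f t x‖ ≤ L) (t₀ : ℝ) (x₀ : E) :
    ∃ γ : ℝ → E, γ t₀ = x₀ ∧ IsIntegralCurveOn γ f (Set.Ici t₀) := by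
  have hpl (n : ℕ) : ∃ γ : ℝ → E, γ t₀ = x₀ ∧
      ∀ t ∈ Set.Icc t₀ (t₀ + n), HasDerivWithinAt γ (f t (γ t)) (Set.Icc t₀ (t₀ + n)) t := by
    -- A field bounded by `L` moves a point by at most `L * n` in time `n`, so with this radius the
    -- Picard–Lindelöf condition puts no limit on the length of the interval.
    have h : IsPicardLindelof f (tmin := t₀) (tmax := t₀ + n)
        ⟨t₀, le_rfl, by simp⟩ x₀ (L * n) 0 L K :=
      { lipschitzOnWith := fun t _ => (hlip t).lipschitzOnWith
        continuousOn := fun x _ => (hcont x).continuousOn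
        norm_le := fun t _ x _ => hL t x
        mul_max_le := by simp }
    exact h.exists_eq_forall_mem_Icc_hasDerivWithinAt₀
  choose γ hγ₀ hγ using hpl
  have hagree {m n : ℕ} (hmn : m ≤ n) : Set.EqOn (γ m) (γ n) (Set.Icc t₀ (t₀ + m)) := by
    have hsub : Set.Icc t₀ (t₀ + (m : ℝ)) ⊆ Set.Icc t₀ (t₀ + n) :=
      Set.Icc_subset_Icc_right (by gcongr)
    have key {k : ℕ} (hk : m ≤ k) (t : ℝ) (ht : t ∈ Set.Ico t₀ (t₀ + (m : ℝ))) :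
        HasDerivWithinAt (γ k) (f t (γ k t)) (Set.Ici t) t := by
      have hk' : (m : ℝ) ≤ k := by exact_mod_cast hk
      have ht' : t < t₀ + k := by linarith [ht.2]
      refine ((hγ k t ⟨ht.1, ht'.le⟩).mono (Set.Icc_subset_Icc_left ht.1)).mono_of_mem_nhdsWithin ?_
      exact Icc_mem_nhdsGE ht'
    refine ODE_solution_unique_of_mem_Icc_right (v := f) (s := fun _ => Set.univ) (K := K)
      (fun t _ => (hlip t).lipschitzOnWith)
      (fun t ht => (hγ m t ht).continuousWithinAt) (key le_rfl) (fun _ _ => trivial)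
      (fun t ht => ((hγ n t (hsub ht)).continuousWithinAt).mono hsub) (key hmn)
      (fun _ _ => trivial) (by rw [hγ₀, hγ₀])
  -- The `+ 1` puts `t` strictly before the right end of its interval, so that a derivative within
  -- the interval is one within the half-line.
  let N (t : ℝ) : ℕ := ⌈t - t₀⌉₊ + 1
  have hN (t : ℝ) : t < t₀ + N t := by
    have := Nat.le_ceil (t - t₀)
    simp only [N]; push_cast; linarith
  refine ⟨fun t => γ (N t) t, hγ₀ _, fun t ht => ?_⟩
  have heq : ∀ u ∈ Set.Icc t₀ (t₀ + N t), γ (N u) u = γ (N t) u := by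
    intro u hu
    rcases le_total (N u) (N t) with h | h
    · exact hagree h ⟨hu.1, (hN u).le⟩
    · exact (hagree h hu).symm
  have h1 := (hγ (N t) t ⟨ht, (hN t).le⟩).congr heq (heq t ⟨ht, (hN t).le⟩)
  refine h1.mono_of_mem_nhdsWithin ?_
  have : Set.Iic (t₀ + N t) ∈ 𝓝 t := Iic_mem_nhds (hN t)
  exact mem_nhdsWithin.2 ⟨Set.Iio (t₀ + N t), isOpen_Iio, hN t, fun u hu => ⟨hu.2, le_of_lt hu.1⟩⟩

/-- A smooth vector field that depends on time through a bounded continuous parameter agrees, on a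
given ball, with a field whose integral curves exist on half-lines and which is a pointwise multiple
of the original one. -/
theorem exists_isIntegralCurveOn_Ici_of_cutoff [FiniteDimensional ℝ E]
    {P : Type*} [NormedAddCommGroup P] [NormedSpace ℝ P] [FiniteDimensional ℝ P]
    {F : P × E → E} (hF : ContDiff ℝ 1 F) {Γ : ℝ → P} (hΓ : Continuous Γ) {M : ℝ}
    (hM : ∀ t, ‖Γ t‖ ≤ M) (xe : E) (ρ : ℝ) (t₀ : ℝ) (x₀ : E) :
    ∃ (χ : ℝ → E → ℝ) (γ : ℝ → E), (∀ t x, ‖x - xe‖ ≤ ρ → χ t x = 1) ∧ γ t₀ = x₀ ∧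
      IsIntegralCurveOn γ (fun t x => χ t x • F (Γ t, x)) (Set.Ici t₀) := by
  have hM0 : 0 ≤ M := (norm_nonneg _).trans (hM 0)
  -- Cutting off in the parameter as well as in the state gives compact support on the product,
  -- hence one Lipschitz constant and one bound for all times.
  let b : ContDiffBump ((0 : P), xe) :=
    { rIn := max M ρ + 1, rOut := max M ρ + 2
      rIn_pos := by have := le_max_left M ρ; linarith
      rIn_lt_rOut := by linarith }
  let F' : P × E → E := fun z => b z • F z
  have hF' : ContDiff ℝ 1 F' := b.contDiff.smul hF
  have hsupp : HasCompactSupport F' := b.hasCompactSupport.smul_right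
  obtain ⟨K, hK⟩ := hF'.lipschitzWith_of_hasCompactSupport hsupp one_ne_zero
  obtain ⟨L, hL⟩ := hsupp.exists_bound_of_continuous hF'.continuous
  have hL0 : 0 ≤ L := (norm_nonneg _).trans (hL 0)
  have : CompleteSpace E := FiniteDimensional.complete ℝ E
  obtain ⟨γ, h0, hγ⟩ := exists_isIntegralCurveOn_Ici_of_bounded_lipschitz
    (f := fun t x => F' (Γ t, x)) (K := K) (L := ⟨L, hL0⟩)
    (fun t => by
      have h := hK.comp (LipschitzWith.prodMk_left (Γ t))
      rwa [mul_one] at h)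
    (fun x => hF'.continuous.comp (hΓ.prodMk continuous_const)) (fun t x => hL _) t₀ x₀
  refine ⟨fun t x => b (Γ t, x), γ, fun t x hx => ?_, h0, hγ⟩
  apply b.one_of_mem_closedBall
  rw [mem_closedBall_iff_norm, Prod.mk_sub_mk, Prod.norm_mk, sub_zero]
  refine max_le ((hM t).trans ?_) (hx.trans ?_)
  · exact (le_max_left M ρ).trans (by simp [b])
  · exact (le_max_right M ρ).trans (by simp [b])

/-- Exponential decay of a curve along which a function comparable with the squared distance
satisfies a dissipation inequality inside a ball. -/
theorem norm_le_exp_of_lyapunov {n v v' : ℝ → ℝ} {a b r ρ t₀ t₁ : ℝ} (ha : 0 < a) (hr : 0 < r)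
    (hρ : 0 < ρ) (hnc : ContinuousOn n (Set.Icc t₀ t₁))
    (hv : ∀ t ∈ Set.Icc t₀ t₁, n t < ρ → a * n t ^ 2 ≤ v t ∧ v t ≤ b * n t ^ 2)
    (hd : ∀ t ∈ Set.Icc t₀ t₁, n t < ρ →
      HasDerivWithinAt v (v' t) (Set.Icc t₀ t₁) t ∧ v' t ≤ -(2 * r) * v t)
    (h0 : n t₀ < ρ) (hb : b * n t₀ ^ 2 < a * (ρ / 2) ^ 2) :
    ∀ t ∈ Set.Icc t₀ t₁, n t < ρ ∧ n t ^ 2 ≤ b / a * n t₀ ^ 2 * Real.exp (-(2 * r) * (t - t₀)) := by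
  have decay : ∀ t ∈ Set.Icc t₀ t₁, (∀ u ∈ Set.Icc t₀ t, n u < ρ) →
      v t ≤ v t₀ * Real.exp (-(2 * r) * (t - t₀)) := by
    intro t ht hu
    have hsub : Set.Icc t₀ t ⊆ Set.Icc t₀ t₁ := Set.Icc_subset_Icc_right ht.2
    have hD : ∀ u ∈ Set.Icc t₀ t, HasDerivWithinAt (fun u => v u * Real.exp (2 * r * (u - t₀)))
        (v' u * Real.exp (2 * r * (u - t₀)) +
          v u * (Real.exp (2 * r * (u - t₀)) * (2 * r * 1))) (Set.Icc t₀ t) u := fun u hu' =>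
      ((hd u (hsub hu') (hu u hu')).1.mono hsub).mul
        ((((hasDerivAt_id u).sub_const t₀).const_mul (2 * r)).exp.hasDerivWithinAt)
    have hanti : AntitoneOn (fun u => v u * Real.exp (2 * r * (u - t₀))) (Set.Icc t₀ t) :=
      antitoneOn_of_hasDerivWithinAt_nonpos (convex_Icc _ _)
        (fun u hu' => (hD u hu').continuousWithinAt)
        (fun u hu' => (hD u (interior_subset hu')).mono interior_subset)
        (fun u hu' => by
          have h := (hd u (hsub (interior_subset hu')) (hu u (interior_subset hu'))).2
          have hE := Real.exp_pos (2 * r * (u - t₀))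
          nlinarith)
    have h := hanti (Set.left_mem_Icc.2 ht.1) (Set.right_mem_Icc.2 ht.1) ht.1
    simp only [sub_self, mul_zero, Real.exp_zero, mul_one] at h
    rw [neg_mul, Real.exp_neg, ← div_eq_mul_inv, le_div_iff₀ (Real.exp_pos _)]
    exact h
  have hlt : ∀ t ∈ Set.Icc t₀ t₁, n t < ρ := by
    -- At a first exit time τ, continuity gives a slightly earlier time with n > ρ/2. Up to then the
    -- decay estimate holds and forces a·n² ≤ b·n(t₀)² < a(ρ/2)².
    by_contra! hcon
    obtain ⟨s, hs, hsρ⟩ := hcon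
    have hcl : IsCompact (Set.Icc t₀ t₁ ∩ n ⁻¹' Set.Ici ρ) :=
      isCompact_Icc.of_isClosed_subset (hnc.preimage_isClosed_of_isClosed isClosed_Icc isClosed_Ici)
        Set.inter_subset_left
    obtain ⟨τ, ⟨hτ, hτρ⟩, hmin⟩ := hcl.exists_isLeast ⟨s, hs, hsρ⟩
    have hτρ : ρ ≤ n τ := hτρ
    have ht₀τ : t₀ < τ := by
      rcases hτ.1.eq_or_lt with h | h
      · rw [← h] at hτρ; linarith
      · exact h
    have hbefore : ∀ u ∈ Set.Ico t₀ τ, n u < ρ := by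
      intro u hu
      by_contra! h
      exact absurd (hmin ⟨⟨hu.1, hu.2.le.trans hτ.2⟩, h⟩) (not_le.2 hu.2)
    have hev : ∀ᶠ u in 𝓝[<] τ, ρ / 2 < n u := by
      have h1 : Tendsto n (𝓝[Set.Icc t₀ t₁] τ) (𝓝 (n τ)) := hnc τ hτ
      have h2 : 𝓝[<] τ ≤ 𝓝[Set.Icc t₀ t₁] τ :=
        nhdsWithin_le_of_mem (mem_of_superset (Ico_mem_nhdsLT ht₀τ)
          (Set.Ico_subset_Icc_self.trans (Set.Icc_subset_Icc_right hτ.2)))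
      exact (h1.mono_left h2).eventually (lt_mem_nhds (by linarith))
    obtain ⟨u, hu, huI⟩ := (hev.and (Ico_mem_nhdsLT ht₀τ)).exists
    have huI' : u ∈ Set.Icc t₀ t₁ := ⟨huI.1, huI.2.le.trans hτ.2⟩
    have h1 := decay u huI' fun w hw => hbefore w ⟨hw.1, hw.2.trans_lt huI.2⟩
    have h2 := (hv u huI' (hbefore u huI)).1
    have h3 := hv t₀ ⟨le_rfl, hs.1.trans hs.2⟩ h0
    have h4 : Real.exp (-(2 * r) * (u - t₀)) ≤ 1 :=
      Real.exp_le_one_iff.2 (by nlinarith [huI.1])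
    have h5 : 0 ≤ v t₀ := le_trans (by positivity) h3.1
    have h6 : v t₀ * Real.exp (-(2 * r) * (u - t₀)) ≤ v t₀ := mul_le_of_le_one_right h5 h4
    have h7 : a * (ρ / 2) ^ 2 ≤ a * n u ^ 2 := by gcongr
    linarith [h3.2]
  intro t ht
  refine ⟨hlt t ht, ?_⟩
  have ht₀ : t₀ ∈ Set.Icc t₀ t₁ := ⟨le_rfl, ht.1.trans ht.2⟩
  have h1 := decay t ht fun u hu => hlt u ⟨hu.1, hu.2.trans ht.2⟩
  have h2 := (hv t ht (hlt t ht)).1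
  have h3 := (hv t₀ ht₀ h0).2
  have h4 := Real.exp_pos (-(2 * r) * (t - t₀))
  have h5 : a * n t ^ 2 ≤ b * n t₀ ^ 2 * Real.exp (-(2 * r) * (t - t₀)) :=
    (h2.trans h1).trans (by gcongr)
  have h6 : b / a * n t₀ ^ 2 * Real.exp (-(2 * r) * (t - t₀)) =
      b * n t₀ ^ 2 * Real.exp (-(2 * r) * (t - t₀)) / a := by ring
  rw [h6, le_div_iff₀ ha]
  linarith

namespace MagneticAttitude

/-- **Lyapunov's theorem** for local exponential stability of an equilibrium of a system on a level
set of a first integral. -/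
theorem isLocallyExpStable_of_lyapunov [FiniteDimensional ℝ E]
    {P : Type*} [NormedAddCommGroup P] [NormedSpace ℝ P] [FiniteDimensional ℝ P]
    {F : P × E → E} (hF : ContDiff ℝ 1 F) {Γ : ℝ → P} (hΓ : Continuous Γ) {M : ℝ}
    (hM : ∀ t, ‖Γ t‖ ≤ M) {f : ℝ → E → E} (hf : ∀ t x, f t x = F (Γ t, x))
    {φ : E → ℝ} {φ' : E → E →L[ℝ] ℝ} (hφ : ∀ x, HasFDerivAt φ (φ' x) x)
    (hφf : ∀ t x, φ' x (f t x) = 0) {φ₀ : ℝ} {X : Set E} (hX : X = {x | φ x = φ₀})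
    {xe : E} (hxe : xe ∈ X) (heq : ∀ t, f t xe = 0)
    {V V' : ℝ → E → ℝ} {a b r ρ : ℝ} (ha : 0 < a) (hr : 0 < r) (hρ : 0 < ρ)
    (hV : ∀ t, ∀ x ∈ X, ‖x - xe‖ < ρ → a * ‖x - xe‖ ^ 2 ≤ V t x ∧ V t x ≤ b * ‖x - xe‖ ^ 2)
    (hVd : ∀ (γ : ℝ → E) (I : Set ℝ) (t : ℝ), HasDerivWithinAt γ (f t (γ t)) I t →
      HasDerivWithinAt (fun u => V u (γ u)) (V' t (γ t)) I t)
    (hVle : ∀ t, ∀ x ∈ X, ‖x - xe‖ < ρ → V' t x ≤ -(2 * r) * V t x) :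
    IsLocallyExpStable f X xe := by
  set b' : ℝ := max b 1 with hb'
  have hb'0 : 0 < b' := lt_max_of_lt_right one_pos
  -- The equation is required only while the curve is inside the ball. The estimate therefore covers
  -- both true solutions and curves of the cut-off field, not yet known to stay there.
  have key : ∀ (γ : ℝ → E) (t₀ t₁ : ℝ), ContinuousOn γ (Set.Icc t₀ t₁) →
      (∀ t ∈ Set.Icc t₀ t₁, γ t ∈ X) →
      (∀ t ∈ Set.Icc t₀ t₁, ‖γ t - xe‖ < ρ →
        HasDerivWithinAt γ (f t (γ t)) (Set.Icc t₀ t₁) t) →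
      ‖γ t₀ - xe‖ < min ρ (√(a / b') * (ρ / 2)) → ∀ t ∈ Set.Icc t₀ t₁,
        ‖γ t - xe‖ < ρ ∧ ‖γ t - xe‖ ≤ √(b' / a) * ‖γ t₀ - xe‖ * Real.exp (-r * (t - t₀)) := by
    intro γ t₀ t₁ hγc hγX hγ h0 t ht
    have h0' := lt_min_iff.1 h0
    have hsq : b' * ‖γ t₀ - xe‖ ^ 2 < a * (ρ / 2) ^ 2 := by
      have h1 : ‖γ t₀ - xe‖ ^ 2 < (√(a / b') * (ρ / 2)) ^ 2 :=
        pow_lt_pow_left₀ h0'.2 (norm_nonneg _) two_ne_zero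
      rw [mul_pow, Real.sq_sqrt (by positivity)] at h1
      calc b' * ‖γ t₀ - xe‖ ^ 2 < b' * (a / b' * (ρ / 2) ^ 2) := by gcongr
        _ = a * (ρ / 2) ^ 2 := by field_simp
    obtain ⟨h1, h2⟩ := norm_le_exp_of_lyapunov (n := fun t => ‖γ t - xe‖)
      (v := fun t => V t (γ t)) (v' := fun t => V' t (γ t)) (b := b') ha hr hρ
      (hγc.sub continuousOn_const).norm
      (fun t ht hlt => ⟨(hV t _ (hγX t ht) hlt).1, (hV t _ (hγX t ht) hlt).2.trans (by
        gcongr; exact le_max_left _ _)⟩)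
      (fun t ht hlt => ⟨hVd γ _ t (hγ t ht hlt), hVle t _ (hγX t ht) hlt⟩) h0'.1 hsq t ht
    refine ⟨h1, (sq_le_sq₀ (norm_nonneg _) (by positivity)).1 ?_⟩
    rw [mul_pow, mul_pow, Real.sq_sqrt (by positivity), ← Real.exp_nat_mul]
    rw [show ((2 : ℕ) : ℝ) * (-r * (t - t₀)) = -(2 * r) * (t - t₀) by push_cast; ring]
    exact h2
  refine ⟨hxe, fun t _ => heq t, min ρ (√(a / b') * (ρ / 2)), by positivity, √(b' / a),
    by positivity, r, hr, fun t₀ _ x₀ hx₀ hc => ⟨?_, ?_⟩⟩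
  · obtain ⟨χ, γ, hχ, h0, hγ⟩ :=
      exists_isIntegralCurveOn_Ici_of_cutoff hF hΓ hM xe ρ t₀ x₀
    have hcont : ContinuousOn γ (Set.Ici t₀) := fun t ht => (hγ t ht).continuousWithinAt
    have hXγ : ∀ t ∈ Set.Ici t₀, γ t ∈ X := by
      intro t ht
      -- The cutoff only rescales the field by a scalar, so it stays tangent to the level sets of φ.
      have hconst : φ (γ t) = φ (γ t₀) := by
        have hder : ∀ u ∈ Set.Ici t₀, HasDerivWithinAt (fun u => φ (γ u)) 0 (Set.Ici t₀) u := by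
          intro u hu
          have h := (hφ (γ u)).comp_hasDerivWithinAt u (hγ u hu)
          rwa [map_smul, ← hf, hφf, smul_zero] at h
        refine constant_of_derivWithin_zero (f := fun u => φ (γ u)) (a := t₀) (b := t) ?_ ?_ t
          ⟨ht, le_rfl⟩
        · exact fun u hu => ((hder u hu.1).mono Set.Icc_subset_Ici_self).differentiableWithinAt
        · intro u hu
          exact ((hder u hu.1).mono Set.Icc_subset_Ici_self).derivWithin
            (uniqueDiffOn_Icc (hu.1.trans_lt hu.2) u ⟨hu.1, hu.2.le⟩)
      rw [hX] at hx₀ ⊢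
      change φ (γ t) = φ₀
      rw [hconst, h0]; exact hx₀
    have hball : ∀ t ∈ Set.Ici t₀, ‖γ t - xe‖ < ρ := by
      intro t ht
      refine (key γ t₀ t (hcont.mono Set.Icc_subset_Ici_self) (fun u hu => hXγ u hu.1) ?_
        (by rwa [h0]) t ⟨ht, le_rfl⟩).1
      intro u hu hlt
      have h := (hγ u hu.1).mono (Set.Icc_subset_Ici_self (a := t) (b := t₀))
      simpa only [hχ u _ hlt.le, one_smul, ← hf] using h
    refine ⟨γ, h0, fun t ht => ?_, hXγ⟩
    have h := hγ t ht
    simpa only [hχ t _ (hball t ht).le, one_smul, ← hf] using h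
  · intro γ t₁ h0 hsol t ht
    have h := key γ t₀ t₁ (fun u hu => (hsol.1 u hu).continuousWithinAt) hsol.2
      (fun u hu _ => hsol.1 u hu) (by rwa [h0]) t ht
    rw [h0] at h
    exact h.2

end MagneticAttitude

end ODE

/-! ### Trigonometric polynomials and their time averages. -/

namespace MagneticAttitude

/-- Real trigonometric polynomials with arbitrary (incommensurable) frequencies. -/
def trigPoly : Submodule ℝ (ℝ → ℝ) :=
  Submodule.span ℝ (Set.range fun p : ℝ × ℝ => fun t : ℝ => Real.cos (p.1 * t + p.2))

theorem cos_mem_trigPoly (a b : ℝ) : (fun t => Real.cos (a * t + b)) ∈ trigPoly :=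
  Submodule.subset_span ⟨(a, b), rfl⟩

theorem sin_mem_trigPoly (a b : ℝ) : (fun t => Real.sin (a * t + b)) ∈ trigPoly := by
  convert cos_mem_trigPoly a (b - Real.pi / 2) using 2 with t
  rw [← Real.cos_sub_pi_div_two, add_sub_assoc]

theorem const_mem_trigPoly (c : ℝ) : (fun _ => c) ∈ trigPoly := by
  convert trigPoly.smul_mem c (cos_mem_trigPoly 0 0) using 2 with t
  simp

/-- Product-to-sum formula on generators, extended bilinearly. -/
theorem mul_mem_trigPoly {f g : ℝ → ℝ} (hf : f ∈ trigPoly) (hg : g ∈ trigPoly) :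
    f * g ∈ trigPoly := by
  unfold trigPoly at hf
  induction hf using Submodule.span_induction with
  | mem f hf =>
    obtain ⟨⟨a, b⟩, rfl⟩ := hf
    unfold trigPoly at hg
    induction hg using Submodule.span_induction with
    | mem g hg =>
      obtain ⟨⟨c, d⟩, rfl⟩ := hg
      convert trigPoly.smul_mem (1 / 2) (trigPoly.add_mem (cos_mem_trigPoly (a + c) (b + d))
        (cos_mem_trigPoly (a - c) (b - d))) using 1
      ext t
      simp only [Pi.mul_apply, Pi.smul_apply, Pi.add_apply, smul_eq_mul]
      rw [show (a + c) * t + (b + d) = (a * t + b) + (c * t + d) by ring,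
        show (a - c) * t + (b - d) = (a * t + b) - (c * t + d) by ring,
        Real.cos_add (a * t + b) (c * t + d), Real.cos_sub (a * t + b) (c * t + d)]
      ring
    | zero => simp
    | add g₁ g₂ _ _ h₁ h₂ => rw [mul_add]; exact trigPoly.add_mem h₁ h₂
    | smul c g _ h => rw [mul_smul_comm]; exact trigPoly.smul_mem c h
  | zero => simp
  | add f₁ f₂ _ _ h₁ h₂ => rw [add_mul]; exact trigPoly.add_mem h₁ h₂
  | smul c f _ h => rw [smul_mul_assoc]; exact trigPoly.smul_mem c h

theorem continuous_of_mem_trigPoly {f : ℝ → ℝ} (hf : f ∈ trigPoly) : Continuous f := by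
  unfold trigPoly at hf
  induction hf using Submodule.span_induction with
  | mem f hf => obtain ⟨⟨a, b⟩, rfl⟩ := hf; fun_prop
  | zero => exact continuous_const
  | add f g _ _ h₁ h₂ => exact h₁.add h₂
  | smul c f _ h => exact h.const_smul c

theorem exists_bound_of_mem_trigPoly {f : ℝ → ℝ} (hf : f ∈ trigPoly) : ∃ M, ∀ t, |f t| ≤ M := by
  unfold trigPoly at hf
  induction hf using Submodule.span_induction with
  | mem f hf => obtain ⟨⟨a, b⟩, rfl⟩ := hf; exact ⟨1, fun t => Real.abs_cos_le_one _⟩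
  | zero => exact ⟨0, by simp⟩
  | add f g _ _ h₁ h₂ =>
    obtain ⟨M, hM⟩ := h₁
    obtain ⟨N, hN⟩ := h₂
    exact ⟨M + N, fun t => (abs_add_le _ _).trans (add_le_add (hM t) (hN t))⟩
  | smul c f _ h =>
    obtain ⟨M, hM⟩ := h
    refine ⟨|c| * M, fun t => ?_⟩
    rw [Pi.smul_apply, smul_eq_mul, abs_mul]
    exact mul_le_mul_of_nonneg_left (hM t) (abs_nonneg c)

/-- A trigonometric polynomial has a mean value `m`, and `∫₀ᵀ (f - m)` is bounded in `T`. -/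
theorem exists_mean_of_mem_trigPoly {f : ℝ → ℝ} (hf : f ∈ trigPoly) :
    ∃ m M : ℝ, ∀ T, |∫ τ in (0 : ℝ)..T, (f τ - m)| ≤ M := by
  have hint {f : ℝ → ℝ} (hf : f ∈ trigPoly) (m T : ℝ) :
      IntervalIntegrable (fun τ => f τ - m) MeasureTheory.volume 0 T :=
    ((continuous_of_mem_trigPoly hf).sub continuous_const).intervalIntegrable _ _
  unfold trigPoly at hf
  induction hf using Submodule.span_induction with
  | mem f hf =>
    obtain ⟨⟨a, b⟩, rfl⟩ := hf
    -- Zero frequency is the only source of mean value; every other frequency has a bounded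
    -- primitive. As the span consists of finite sums, no small divisors arise.
    rcases eq_or_ne a 0 with rfl | ha
    · exact ⟨Real.cos b, 0, fun T => by simp⟩
    · refine ⟨0, |a⁻¹| * 2, fun T => ?_⟩
      have h : ∫ τ in (0 : ℝ)..T, (Real.cos (a * τ + b) - 0) =
          a⁻¹ * (Real.sin (a * T + b) - Real.sin (a * 0 + b)) := by
        simp only [sub_zero]
        rw [intervalIntegral.integral_comp_mul_add _ ha, integral_cos, smul_eq_mul]
      rw [h, abs_mul]
      gcongr
      refine (abs_sub _ _).trans ?_
      linarith [Real.abs_sin_le_one (a * T + b), Real.abs_sin_le_one (a * 0 + b)]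
  | zero => exact ⟨0, 0, by simp⟩
  | add f g hf hg h₁ h₂ =>
    obtain ⟨m, M, hM⟩ := h₁
    obtain ⟨n, N, hN⟩ := h₂
    refine ⟨m + n, M + N, fun T => ?_⟩
    have h : ∫ τ in (0 : ℝ)..T, ((f + g) τ - (m + n)) =
        (∫ τ in (0 : ℝ)..T, (f τ - m)) + ∫ τ in (0 : ℝ)..T, (g τ - n) := by
      rw [← intervalIntegral.integral_add (hint hf m T) (hint hg n T)]
      congr 1; ext τ; simp only [Pi.add_apply]; ring
    rw [h]
    exact (abs_add_le _ _).trans (add_le_add (hM T) (hN T))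
  | smul c f hf h =>
    obtain ⟨m, M, hM⟩ := h
    refine ⟨c * m, |c| * M, fun T => ?_⟩
    have h : ∫ τ in (0 : ℝ)..T, ((c • f) τ - c * m) = c * ∫ τ in (0 : ℝ)..T, (f τ - m) := by
      rw [← intervalIntegral.integral_const_mul]
      congr 1; ext τ; simp only [Pi.smul_apply, smul_eq_mul]; ring
    rw [h, abs_mul]
    exact mul_le_mul_of_nonneg_left (hM T) (abs_nonneg c)

/-- The average differs from `m` by at most M/T. -/
theorem tendsto_average_of_bounded {f : ℝ → ℝ} (hf : Continuous f) {m M : ℝ}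
    (hM : ∀ T, |∫ τ in (0 : ℝ)..T, (f τ - m)| ≤ M) :
    Tendsto (fun T : ℝ => (1 / T) * ∫ τ in (0 : ℝ)..T, f τ) atTop (𝓝 m) := by
  have h0 : Tendsto (fun T : ℝ => (1 / T) * ∫ τ in (0 : ℝ)..T, (f τ - m)) atTop (𝓝 0) := by
    have h := tendsto_const_nhds (x := M) (f := (atTop : Filter ℝ)) |>.mul tendsto_inv_atTop_zero
    rw [mul_zero] at h
    refine squeeze_zero_norm' ?_ h
    filter_upwards [eventually_gt_atTop 0] with T hT
    rw [Real.norm_eq_abs, abs_mul, abs_of_pos (one_div_pos.2 hT), one_div, mul_comm]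
    exact mul_le_mul_of_nonneg_right (hM T) (inv_pos.2 hT).le
  have h1 := h0.add_const m
  rw [zero_add] at h1
  refine h1.congr' ?_
  filter_upwards [eventually_gt_atTop 0] with T hT
  rw [intervalIntegral.integral_sub (hf.intervalIntegrable _ _)
    (continuous_const.intervalIntegrable _ _), intervalIntegral.integral_const, smul_eq_mul]
  field_simp
  ring

/-! ### The geomagnetic field as a trigonometric polynomial. -/

namespace DipoleOrbit

variable (o : DipoleOrbit)

theorem norm_position (t : ℝ) : ‖o.position t‖ = o.R := by
  rw [EuclideanSpace.norm_eq, ← Real.sqrt_sq o.R_pos.le]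
  congr 1
  simp only [position, orbitRotation, Fin.sum_univ_three, Matrix.mul_apply, Matrix.mulVec,
    dotProduct, Matrix.of_apply, Real.norm_eq_abs, sq_abs, Matrix.cons_val', Matrix.cons_val_zero,
    Matrix.cons_val_one, Matrix.cons_val]
  have h1 := Real.sin_sq_add_cos_sq (o.n * t + o.phi0)
  have h2 := Real.sin_sq_add_cos_sq o.Omega
  have h3 := Real.sin_sq_add_cos_sq o.incl
  generalize Real.sin (o.n * t + o.phi0) = S at *
  generalize Real.cos (o.n * t + o.phi0) = C at *
  simp
  linear_combination o.R ^ 2 * (C ^ 2 + Real.cos o.incl ^ 2 * S ^ 2) * h2 +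
    o.R ^ 2 * S ^ 2 * h3 + o.R ^ 2 * h1

theorem position_mem_trigPoly (i : Fin 3) : (fun t => o.position t i) ∈ trigPoly := by
  have h : (fun t => o.position t i) = fun t =>
      (o.orbitRotation i 0 * o.R) * Real.cos (o.n * t + o.phi0) +
        (o.orbitRotation i 1 * o.R) * Real.sin (o.n * t + o.phi0) := by
    ext t
    simp [position, Matrix.mulVec, dotProduct, Fin.sum_univ_three]
    ring
  rw [h]
  exact trigPoly.add_mem (trigPoly.smul_mem _ (cos_mem_trigPoly _ _))
    (trigPoly.smul_mem _ (sin_mem_trigPoly _ _))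

theorem dipoleDir_mem_trigPoly (i : Fin 3) : (fun t => o.dipoleDir t i) ∈ trigPoly := by
  fin_cases i
  · exact trigPoly.smul_mem _ (cos_mem_trigPoly o.omegaE o.alpha0)
  · exact trigPoly.smul_mem _ (sin_mem_trigPoly o.omegaE o.alpha0)
  · exact const_mem_trigPoly _

/-- Since ‖r‖ is the constant R, the denominators are constants and the field is a polynomial in the
components of position and dipole. -/
theorem field_mem_trigPoly (i : Fin 3) : (fun t => o.field t i) ∈ trigPoly := by
  have hp (j : Fin 3) : (fun t => o.positionDir t j) ∈ trigPoly := by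
    convert trigPoly.smul_mem o.R⁻¹ (o.position_mem_trigPoly j) using 1
    ext t
    simp [positionDir, norm_position]
  have h : (fun t => o.field t i) = (o.mu / o.R ^ 3) • ((3 : ℝ) •
      ((∑ j, (fun t => o.dipoleDir t j) * fun t => o.positionDir t j) *
        fun t => o.positionDir t i) - fun t => o.dipoleDir t i) := by
    ext t
    simp [field, norm_position, PiLp.inner_apply, Fin.sum_univ_three]
    ring_nf
    simp
  rw [h]
  exact trigPoly.smul_mem _ (trigPoly.sub_mem (trigPoly.smul_mem _ (mul_mem_trigPoly
    (trigPoly.sum_mem fun j _ => mul_mem_trigPoly (o.dipoleDir_mem_trigPoly j) (hp j)) (hp i)))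
    (o.dipoleDir_mem_trigPoly i))

theorem Gamma_mem_trigPoly (i j : Fin 3) : (fun t => o.Gamma t i j) ∈ trigPoly := by
  have hs (i j : Fin 3) : (fun t => skew (o.field t) i j) ∈ trigPoly := by
    fin_cases i <;> fin_cases j <;>
      first
      | exact o.field_mem_trigPoly _
      | exact trigPoly.neg_mem (o.field_mem_trigPoly _)
      | exact const_mem_trigPoly 0
  have h : (fun t => o.Gamma t i j) =
      ∑ k, (fun t => skew (o.field t) i k) * fun t => skew (o.field t) j k := by
    ext t
    simp [Gamma, Matrix.mul_apply]
  rw [h]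
  exact trigPoly.sum_mem fun k _ => mul_mem_trigPoly (hs i k) (hs j k)

/-- The time average of `Γ` exists and the integral of the deviation from it is bounded. -/
theorem exists_hasTimeAverage_Gamma : ∃ Γav : Matrix (Fin 3) (Fin 3) ℝ,
    HasTimeAverage o.Gamma Γav ∧
      ∀ i j, ∃ M, ∀ T, |∫ τ in (0 : ℝ)..T, (o.Gamma τ i j - Γav i j)| ≤ M := by
  choose m M hM using fun i j => exists_mean_of_mem_trigPoly (o.Gamma_mem_trigPoly i j)
  refine ⟨Matrix.of m, ?_, fun i j => ⟨M i j, hM i j⟩⟩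
  refine tendsto_pi_nhds.2 fun i => tendsto_pi_nhds.2 fun j => ?_
  exact tendsto_average_of_bounded (continuous_of_mem_trigPoly (o.Gamma_mem_trigPoly i j)) (hM i j)

end DipoleOrbit

/-! ### Quadratic Lyapunov function of the averaged linear system. -/

section Averaged

/-- Young's inequality for a product with a coefficient. -/
theorem mul_mul_le_of_sq_le {a b c : ℝ} (ha : 0 < a) (h : c ^ 2 ≤ 4 * a * b) (x y : ℝ) :
    c * (x * y) ≤ a * x ^ 2 + b * y ^ 2 := by
  have h1 : 0 ≤ (2 * a * x - c * y) ^ 2 + (4 * a * b - c ^ 2) * y ^ 2 := by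
    have := sub_nonneg.2 h
    positivity
  have h2 : 0 ≤ 4 * a * (a * x ^ 2 + b * y ^ 2 - c * (x * y)) := by linarith
  linarith [nonneg_of_mul_nonneg_right h2 (by positivity)]

/-- The squared norm of a triple. -/
def tripleSq {E : Type*} [NormedAddCommGroup E] (p h s : E) : ℝ := ‖p‖ ^ 2 + ‖h‖ ^ 2 + ‖s‖ ^ 2

/-- The sum norm of a triple. -/
def tripleNorm {E : Type*} [NormedAddCommGroup E] (p h s : E) : ℝ := ‖p‖ + ‖h‖ + ‖s‖

theorem sq_tripleNorm_le {E : Type*} [NormedAddCommGroup E] (p h s : E) :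
    tripleNorm p h s ^ 2 ≤ 3 * tripleSq p h s := by
  simp only [tripleNorm, tripleSq]
  nlinarith [sq_nonneg (‖p‖ - ‖h‖), sq_nonneg (‖p‖ - ‖s‖), sq_nonneg (‖h‖ - ‖s‖)]

variable {E : Type*} [NormedAddCommGroup E] [InnerProductSpace ℝ E]

/-- A quadratic Lyapunov function for the system
`p' = K h / 2`, `h' = -G (k p + c s)`, `s' = K h / 2 - b s`. -/
def lyapFun (κ k c : ℝ) (K G : E →L[ℝ] E) (p h s : E) : ℝ :=
  1 / 2 * inner ℝ h (K h) + k * inner ℝ p (G p) + c * inner ℝ s (G s) + κ * inner ℝ h p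
    - 2 * κ * inner ℝ h s

/-- The derivative of `lyapFun` at `(p, h, s)` in the direction `(p', h', s')`. -/
def lyapDeriv (κ k c : ℝ) (K G : E →L[ℝ] E) (p h s p' h' s' : E) : ℝ :=
  inner ℝ h' (K h) + 2 * k * inner ℝ p' (G p) + 2 * c * inner ℝ s' (G s)
    + κ * (inner ℝ h' p + inner ℝ h p') - 2 * κ * (inner ℝ h' s + inner ℝ h s')

theorem lyapDeriv_add (κ k c : ℝ) (K G : E →L[ℝ] E) (p h s p₁ h₁ s₁ p₂ h₂ s₂ : E) :
    lyapDeriv κ k c K G p h s (p₁ + p₂) (h₁ + h₂) (s₁ + s₂) =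
      lyapDeriv κ k c K G p h s p₁ h₁ s₁ + lyapDeriv κ k c K G p h s p₂ h₂ s₂ := by
  simp only [lyapDeriv, inner_add_left, inner_add_right]
  ring

theorem lyapDeriv_smul (κ k c : ℝ) (K G : E →L[ℝ] E) (p h s p₁ h₁ s₁ : E) (a : ℝ) :
    lyapDeriv κ k c K G p h s (a • p₁) (a • h₁) (a • s₁) =
      a * lyapDeriv κ k c K G p h s p₁ h₁ s₁ := by
  simp only [lyapDeriv, real_inner_smul_left, real_inner_smul_right]
  ring

theorem hasDerivWithinAt_lyapFun {κ k c : ℝ} {K G : E →L[ℝ] E}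
    (hK : ∀ x y, inner ℝ x (K y) = inner ℝ y (K x)) (hG : ∀ x y, inner ℝ x (G y) = inner ℝ y (G x))
    {p h s : ℝ → E} {p' h' s' : E} {I : Set ℝ} {t : ℝ} (hp : HasDerivWithinAt p p' I t)
    (hh : HasDerivWithinAt h h' I t) (hs : HasDerivWithinAt s s' I t) :
    HasDerivWithinAt (fun u => lyapFun κ k c K G (p u) (h u) (s u))
      (lyapDeriv κ k c K G (p t) (h t) (s t) p' h' s') I t := by
  have hd (A : E →L[ℝ] E) {f : ℝ → E} {f' : E} (hf : HasDerivWithinAt f f' I t) :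
      HasDerivWithinAt (fun u => A (f u)) (A f') I t := A.hasFDerivAt.comp_hasDerivWithinAt t hf
  have := (((((hh.inner ℝ (hd K hh)).const_mul (1 / 2)).add ((hp.inner ℝ (hd G hp)).const_mul k)).add
    ((hs.inner ℝ (hd G hs)).const_mul c)).add ((hh.inner ℝ hp).const_mul κ)).sub
    ((hh.inner ℝ hs).const_mul (2 * κ))
  convert! this using 1
  rw [lyapDeriv, hK (h t) h', hG (p t) p', hG (s t) s']
  ring

/-- Along the averaged system the Lyapunov function has an explicit derivative. -/
theorem lyapDeriv_averaged (κ k c b : ℝ) {K G : E →L[ℝ] E}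
    (hG : ∀ x y, inner ℝ x (G y) = inner ℝ y (G x)) (p h s : E) :
    lyapDeriv κ k c K G p h s ((1 / 2 : ℝ) • K h) (-G (k • p + c • s))
        ((1 / 2 : ℝ) • K h - b • s) =
      -(κ / 2) * inner ℝ h (K h) - κ * k * inner ℝ p (G p)
        - (2 * c * b - 2 * κ * c) * inner ℝ s (G s)
        + κ * (2 * k - c) * inner ℝ p (G s) + 2 * κ * b * inner ℝ h s := by
  simp only [lyapDeriv, map_add, map_smul, inner_neg_left, inner_add_left, real_inner_smul_left,
    real_inner_smul_right, inner_sub_left, inner_sub_right]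
  rw [real_inner_comm (K h) (G p), real_inner_comm (K h) (G s), real_inner_comm p (G p),
    real_inner_comm p (G s), real_inner_comm s (G p), real_inner_comm s (G s), hG s p]
  ring

theorem abs_inner_apply_le {A : E →L[ℝ] E} {a : ℝ} (hA : ∀ x, ‖A x‖ ≤ a * ‖x‖) (x y : E) :
    |inner ℝ x (A y)| ≤ a * (‖x‖ * ‖y‖) :=
  (abs_real_inner_le_norm x (A y)).trans (by
    nlinarith [mul_le_mul_of_nonneg_left (hA y) (norm_nonneg x)])

theorem min_mul_tripleSq_le {F : Type*} [NormedAddCommGroup F] (a₁ a₂ a₃ : ℝ) (p h s : F) :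
    min a₂ (min a₁ a₃) * tripleSq p h s ≤ a₁ * ‖p‖ ^ 2 + a₂ * ‖h‖ ^ 2 + a₃ * ‖s‖ ^ 2 := by
  rw [tripleSq, mul_add, mul_add]
  gcongr <;> simp

/-- Young's inequality lets each cross term consume ka/8 of the ka/2 available for ‖h‖², and half of
the coefficient of ‖p‖² or ‖s‖². It needs bounds on κ²; `κ ≤ 1` reduces them to the linear bounds on
κ. -/
theorem le_lyapFun {κ g ka k c : ℝ} {K G : E →L[ℝ] E} (hka : 0 < ka) (hk : 0 < k)
    (hc : 0 < c) (hκ0 : 0 < κ) (hκ1 : κ ≤ 1) (hκ2 : κ ≤ ka * k * g / 4) (hκ3 : κ ≤ ka * c * g / 16)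
    (hG : ∀ x, g * ‖x‖ ^ 2 ≤ inner ℝ x (G x)) (hK : ∀ x, ka * ‖x‖ ^ 2 ≤ inner ℝ x (K x))
    (p h s : E) :
    min (ka / 4) (min (k * g / 2) (c * g / 2)) * tripleSq p h s ≤ lyapFun κ k c K G p h s := by
  have hi (x y : E) : |inner ℝ x y| ≤ ‖x‖ * ‖y‖ := abs_real_inner_le_norm x y
  have h1 : κ * (‖h‖ * ‖p‖) ≤ ka / 8 * ‖h‖ ^ 2 + k * g / 2 * ‖p‖ ^ 2 := by
    exact mul_mul_le_of_sq_le (by positivity) (by nlinarith) _ _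
  have h2 : 2 * κ * (‖h‖ * ‖s‖) ≤ ka / 8 * ‖h‖ ^ 2 + c * g / 2 * ‖s‖ ^ 2 := by
    exact mul_mul_le_of_sq_le (by positivity) (by nlinarith) _ _
  have h3 := neg_le_of_abs_le (hi h p)
  have h4 := le_of_abs_le (hi h s)
  have h5 := min_mul_tripleSq_le (k * g / 2) (ka / 4) (c * g / 2) p h s
  have h6 := mul_le_mul_of_nonneg_left (hG p) hk.le
  have h7 := mul_le_mul_of_nonneg_left (hG s) hc.le
  have h8 := hK h
  have h9 := mul_le_mul_of_nonneg_left h3 hκ0.le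
  have h10 := mul_le_mul_of_nonneg_left h4 hκ0.le
  rw [lyapFun]
  linarith

theorem lyapFun_le {κ g' kb k c : ℝ} {K G : E →L[ℝ] E} (hg' : 0 ≤ g') (hkb : 0 ≤ kb) (hk : 0 < k)
    (hc : 0 < c) (hκ0 : 0 < κ) (hG' : ∀ x, ‖G x‖ ≤ g' * ‖x‖) (hK' : ∀ x, ‖K x‖ ≤ kb * ‖x‖)
    (p h s : E) :
    lyapFun κ k c K G p h s ≤
      (kb + 2 * k * g' + 2 * c * g' + 3 * κ + 1) * tripleNorm p h s ^ 2 := by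
  have hi (x y : E) : |inner ℝ x y| ≤ ‖x‖ * ‖y‖ := abs_real_inner_le_norm x y
  have hiG (x y : E) : |inner ℝ x (G y)| ≤ g' * (‖x‖ * ‖y‖) := abs_inner_apply_le hG' x y
  have hiK (x y : E) : |inner ℝ x (K y)| ≤ kb * (‖x‖ * ‖y‖) := abs_inner_apply_le hK' x y
  have hP := norm_nonneg p
  have hH := norm_nonneg h
  have hS := norm_nonneg s
  have h1 := le_of_abs_le (hiK h h)
  have h2 := mul_le_mul_of_nonneg_left (le_of_abs_le (hiG p p)) hk.le
  have h3 := mul_le_mul_of_nonneg_left (le_of_abs_le (hiG s s)) hc.le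
  have h4 := mul_le_mul_of_nonneg_left (le_of_abs_le (hi h p)) hκ0.le
  have h5 := mul_le_mul_of_nonneg_left (neg_le_of_abs_le (hi h s)) hκ0.le
  have h6 : lyapFun κ k c K G p h s ≤ 1 / 2 * (kb * (‖h‖ * ‖h‖)) + k * (g' * (‖p‖ * ‖p‖)) +
      c * (g' * (‖s‖ * ‖s‖)) + κ * (‖h‖ * ‖p‖) + 2 * κ * (‖h‖ * ‖s‖) := by
    rw [lyapFun]; linarith
  refine h6.trans ?_
  -- The constant is generous enough that the expanded difference has only nonnegative coefficients.
  rw [tripleNorm, ← sub_nonneg]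
  ring_nf
  positivity

/-- Young's inequality spends half of the decay in p and in h on the indefinite terms and moves the
rest of their cost to ‖s‖². That cost is of order κ, whereas the decay in s is of order one, so
small κ suffices. -/
theorem lyapDeriv_averaged_le {κ g g' ka k c b : ℝ} {K G : E →L[ℝ] E} (hg : 0 < g)
    (hka : 0 < ka) (hk : 0 < k) (hc : 0 < c) (hb : 0 < b) (hκ0 : 0 < κ) (hκ4 : κ ≤ b / 2)
    (hκ5 : κ * ((|2 * k - c| * g') ^ 2 / (2 * k * g) + 4 * b ^ 2 / ka + 1) ≤ c * b * g / 2)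
    (hGs : ∀ x y, inner ℝ x (G y) = inner ℝ y (G x))
    (hG : ∀ x, g * ‖x‖ ^ 2 ≤ inner ℝ x (G x)) (hG' : ∀ x, ‖G x‖ ≤ g' * ‖x‖)
    (hK : ∀ x, ka * ‖x‖ ^ 2 ≤ inner ℝ x (K x)) (p h s : E) :
    lyapDeriv κ k c K G p h s ((1 / 2 : ℝ) • K h) (-G (k • p + c • s)) ((1 / 2 : ℝ) • K h - b • s) ≤
      -min (κ * ka / 4) (min (κ * k * g / 2) (c * b * g / 2)) * tripleSq p h s := by
  have hi (x y : E) : |inner ℝ x y| ≤ ‖x‖ * ‖y‖ := abs_real_inner_le_norm x y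
  have hiG (x y : E) : |inner ℝ x (G y)| ≤ g' * (‖x‖ * ‖y‖) := abs_inner_apply_le hG' x y
  rw [lyapDeriv_averaged κ k c b hGs]
  have h1 : |2 * k - c| * g' * (‖p‖ * ‖s‖) ≤ k * g / 2 * ‖p‖ ^ 2 +
      (|2 * k - c| * g') ^ 2 / (2 * k * g) * ‖s‖ ^ 2 := by
    exact mul_mul_le_of_sq_le (by positivity) (le_of_eq (by field_simp; ring)) _ _
  have h2 : 2 * b * (‖h‖ * ‖s‖) ≤ ka / 4 * ‖h‖ ^ 2 + 4 * b ^ 2 / ka * ‖s‖ ^ 2 := by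
    exact mul_mul_le_of_sq_le (by positivity) (le_of_eq (by field_simp; ring)) _ _
  have h3 : (2 * k - c) * inner ℝ p (G s) ≤ |2 * k - c| * g' * (‖p‖ * ‖s‖) := by
    refine (le_abs_self _).trans ?_
    rw [abs_mul, mul_assoc]
    exact mul_le_mul_of_nonneg_left (hiG p s) (abs_nonneg _)
  have h4 := mul_le_mul_of_nonneg_left (le_of_abs_le (hi h s)) (by positivity : 0 ≤ 2 * b)
  have h5 : κ * ((2 * k - c) * inner ℝ p (G s) + 2 * b * inner ℝ h s) ≤
      κ * (k * g / 2 * ‖p‖ ^ 2 + ka / 4 * ‖h‖ ^ 2) + c * b * g / 2 * ‖s‖ ^ 2 := by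
    have e1 := mul_le_mul_of_nonneg_right hκ5 (sq_nonneg ‖s‖)
    have e2 := mul_le_mul_of_nonneg_left (h3.trans h1) hκ0.le
    have e3 := mul_le_mul_of_nonneg_left (h4.trans h2) hκ0.le
    have e4 : 0 ≤ κ * ‖s‖ ^ 2 := by positivity
    linarith
  have h6 := mul_le_mul_of_nonneg_left (hK h) (by positivity : 0 ≤ κ / 2)
  have h7 := mul_le_mul_of_nonneg_left (hG p) (by positivity : 0 ≤ κ * k)
  have h8 := mul_le_mul (by nlinarith : c * b ≤ 2 * c * b - 2 * κ * c) (hG s) (by positivity)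
    (by nlinarith)
  have h9 := min_mul_tripleSq_le (κ * k * g / 2) (κ * ka / 4) (c * b * g / 2) p h s
  linarith

/-- The derivative is bilinear in the two triples, and the product of the sum norms dominates each
product of components. The constant is that of `lyapFun_le`, so a single `C` serves both. -/
theorem abs_lyapDeriv_le {κ g' kb k c : ℝ} {K G : E →L[ℝ] E} (hg' : 0 ≤ g') (hkb : 0 ≤ kb)
    (hk : 0 < k) (hc : 0 < c) (hκ0 : 0 < κ) (hG' : ∀ x, ‖G x‖ ≤ g' * ‖x‖)
    (hK' : ∀ x, ‖K x‖ ≤ kb * ‖x‖) (p h s p' h' s' : E) :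
    |lyapDeriv κ k c K G p h s p' h' s'| ≤
      (kb + 2 * k * g' + 2 * c * g' + 3 * κ + 1) * tripleNorm p h s * tripleNorm p' h' s' := by
  have hi (x y : E) : |inner ℝ x y| ≤ ‖x‖ * ‖y‖ := abs_real_inner_le_norm x y
  have hiG (x y : E) : |inner ℝ x (G y)| ≤ g' * (‖x‖ * ‖y‖) := abs_inner_apply_le hG' x y
  have hiK (x y : E) : |inner ℝ x (K y)| ≤ kb * (‖x‖ * ‖y‖) := abs_inner_apply_le hK' x y
  have hP := norm_nonneg p
  have hH := norm_nonneg h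
  have hS := norm_nonneg s
  have hP' := norm_nonneg p'
  have hH' := norm_nonneg h'
  have hS' := norm_nonneg s'
  have hm {a x y : ℝ} (ha : 0 ≤ a) (hxy : |x| ≤ y) : |a * x| ≤ a * y := by
    rw [abs_mul, abs_of_nonneg ha]
    exact mul_le_mul_of_nonneg_left hxy ha
  have h1 := abs_le.1 (hiK h' h)
  have h2 := abs_le.1 (hm (by positivity : 0 ≤ 2 * k) (hiG p' p))
  have h3 := abs_le.1 (hm (by positivity : 0 ≤ 2 * c) (hiG s' s))
  have h4 := abs_le.1 (hm hκ0.le (hi h' p))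
  have h5 := abs_le.1 (hm hκ0.le (hi h p'))
  have h6 := abs_le.1 (hm hκ0.le (hi h' s))
  have h7 := abs_le.1 (hm hκ0.le (hi h s'))
  have h8 : |lyapDeriv κ k c K G p h s p' h' s'| ≤ kb * (‖h'‖ * ‖h‖) +
      2 * k * (g' * (‖p'‖ * ‖p‖)) + 2 * c * (g' * (‖s'‖ * ‖s‖)) +
      (κ * (‖h'‖ * ‖p‖) + κ * (‖h‖ * ‖p'‖)) +
      2 * (κ * (‖h'‖ * ‖s‖) + κ * (‖h‖ * ‖s'‖)) := by
    rw [lyapDeriv, abs_le]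
    constructor <;> linarith
  refine h8.trans ?_
  have hC' : 0 ≤ 2 * k * g' := by positivity
  have hC'' : 0 ≤ 2 * c * g' := by positivity
  have hprod : tripleNorm p h s * tripleNorm p' h' s' =
      ‖p'‖ * ‖p‖ + ‖h'‖ * ‖h‖ + ‖s'‖ * ‖s‖ + (‖h'‖ * ‖p‖ + ‖h‖ * ‖p'‖) +
        (‖h'‖ * ‖s‖ + ‖h‖ * ‖s'‖) + (‖p'‖ * ‖s‖ + ‖p‖ * ‖s'‖) := by
    rw [tripleNorm, tripleNorm]; ring
  have hpp := mul_nonneg hP' hP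
  have hhh := mul_nonneg hH' hH
  have hss := mul_nonneg hS' hS
  have hhp := add_nonneg (mul_nonneg hH' hP) (mul_nonneg hH hP')
  have hhs := add_nonneg (mul_nonneg hH' hS) (mul_nonneg hH hS')
  have hps := add_nonneg (mul_nonneg hP' hS) (mul_nonneg hP hS')
  have b1 := mul_le_mul_of_nonneg_left
    (by linarith : ‖h'‖ * ‖h‖ ≤ tripleNorm p h s * tripleNorm p' h' s') hkb
  have b2 := mul_le_mul_of_nonneg_left
    (by linarith : ‖p'‖ * ‖p‖ ≤ tripleNorm p h s * tripleNorm p' h' s') hC'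
  have b3 := mul_le_mul_of_nonneg_left
    (by linarith : ‖s'‖ * ‖s‖ ≤ tripleNorm p h s * tripleNorm p' h' s') hC''
  have b4 := mul_le_mul_of_nonneg_left (by linarith :
    ‖h'‖ * ‖p‖ + ‖h‖ * ‖p'‖ ≤ tripleNorm p h s * tripleNorm p' h' s') hκ0.le
  have b5 := mul_le_mul_of_nonneg_left (by linarith :
    ‖h'‖ * ‖s‖ + ‖h‖ * ‖s'‖ ≤ tripleNorm p h s * tripleNorm p' h' s') hκ0.le
  have b6 : 0 ≤ tripleNorm p h s * tripleNorm p' h' s' := by linarith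
  rw [mul_assoc]
  linarith

variable (E) in
/-- The Lyapunov function is positive definite, decays along the averaged system and has bounded
coefficients, with constants that depend on `K` only through bounds. -/
theorem exists_lyapFun_bounds {g g' ka kb k c b : ℝ} (hg : 0 < g) (hg' : 0 ≤ g') (hka : 0 < ka)
    (hkb : 0 ≤ kb) (hk : 0 < k) (hc : 0 < c) (hb : 0 < b) :
    ∃ κ a m C : ℝ, 0 < a ∧ 0 < m ∧ 0 < C ∧ ∀ K G : E →L[ℝ] E,
      (∀ x y, inner ℝ x (G y) = inner ℝ y (G x)) →
      (∀ x, g * ‖x‖ ^ 2 ≤ inner ℝ x (G x)) → (∀ x, ‖G x‖ ≤ g' * ‖x‖) →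
      (∀ x, ka * ‖x‖ ^ 2 ≤ inner ℝ x (K x)) → (∀ x, ‖K x‖ ≤ kb * ‖x‖) →
      ∀ p h s : E,
        a * tripleSq p h s ≤ lyapFun κ k c K G p h s ∧
        lyapFun κ k c K G p h s ≤ C * tripleNorm p h s ^ 2 ∧
        lyapDeriv κ k c K G p h s ((1 / 2 : ℝ) • K h) (-G (k • p + c • s))
          ((1 / 2 : ℝ) • K h - b • s) ≤ -m * tripleSq p h s ∧
        ∀ p' h' s', |lyapDeriv κ k c K G p h s p' h' s'| ≤
          C * tripleNorm p h s * tripleNorm p' h' s' := by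
  -- The first three upper bounds make the function positive definite, the last two make its
  -- derivative negative definite. κ is fixed before `K`, from the bounds alone.
  obtain ⟨κ, hκ0, hκ1, hκ2, hκ3, hκ4, hκ5⟩ : ∃ κ : ℝ, 0 < κ ∧ κ ≤ 1 ∧ κ ≤ ka * k * g / 4 ∧
      κ ≤ ka * c * g / 16 ∧ κ ≤ b / 2 ∧
      κ * ((|2 * k - c| * g') ^ 2 / (2 * k * g) + 4 * b ^ 2 / ka + 1) ≤ c * b * g / 2 := by
    have hD : 0 < (|2 * k - c| * g') ^ 2 / (2 * k * g) + 4 * b ^ 2 / ka + 1 := by positivity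
    refine ⟨min 1 (min (ka * k * g / 4) (min (ka * c * g / 16) (min (b / 2)
      (c * b * g / 2 / ((|2 * k - c| * g') ^ 2 / (2 * k * g) + 4 * b ^ 2 / ka + 1))))),
      by positivity, by simp, by simp, by simp, by simp, ?_⟩
    rw [← le_div_iff₀ hD]
    simp
  refine ⟨κ, min (ka / 4) (min (k * g / 2) (c * g / 2)),
    min (κ * ka / 4) (min (κ * k * g / 2) (c * b * g / 2)),
    kb + 2 * k * g' + 2 * c * g' + 3 * κ + 1, by positivity, by positivity, by clear hκ2 hκ3 hκ5; positivity, ?_⟩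
  intro K G hGs hG hG' hK hK' p h s
  exact ⟨le_lyapFun hka hk hc hκ0 hκ1 hκ2 hκ3 hG hK p h s,
    lyapFun_le hg' hkb hk hc hκ0 hG' hK' p h s,
    lyapDeriv_averaged_le hg hka hk hc hb hκ0 hκ4 hκ5 hGs hG hG' hK p h s,
    abs_lyapDeriv_le hg' hkb hk hc hκ0 hG' hK' p h s⟩

end Averaged

/-! ### Averaging: decay survives errors of order ε². -/

section Perturbed

variable {E : Type*} [NormedAddCommGroup E] [InnerProductSpace ℝ E]

theorem tripleNorm_nonneg {F : Type*} [NormedAddCommGroup F] (p h s : F) :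
    0 ≤ tripleNorm p h s := by
  unfold tripleNorm; positivity

/-- Size of the terms by which the system with the averaging coordinate `h + ε H (k p + c s)`
differs from the averaged one. -/
theorem tripleNorm_averaging_error_le {ε M kb k c b : ℝ} {K H : E →L[ℝ] E} (hε : 0 < ε)
    (hε1 : ε ≤ 1) (hM : 0 ≤ M) (hkb : 0 ≤ kb) (hk : 0 < k) (hc : 0 < c) (hb : 0 < b)
    (hK : ∀ x, ‖K x‖ ≤ kb * ‖x‖) (hH : ∀ x, ‖H x‖ ≤ M * ‖x‖) (p h s rp rh : E) :
    tripleNorm (rp - (ε ^ 2 / 2) • K (H (k • p + c • s)))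
        (rh + ε • H (k • (ε • ((1 / 2 : ℝ) • K (h - ε • H (k • p + c • s))) + rp)
          + c • (ε • ((1 / 2 : ℝ) • K (h - ε • H (k • p + c • s)) - b • s) + rp)))
        (rp - (ε ^ 2 / 2) • K (H (k • p + c • s))) ≤
      ε ^ 2 * (M * (k + c) * (kb + kb * (1 + M * (k + c)) + b)) * tripleNorm p h s
        + (2 + M * (k + c)) * (‖rp‖ + ‖rh‖) := by
  set n := tripleNorm p h s with hn
  have hP : ‖p‖ ≤ n := by simp only [hn, tripleNorm]; linarith [norm_nonneg h, norm_nonneg s]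
  have hh : ‖h‖ ≤ n := by simp only [hn, tripleNorm]; linarith [norm_nonneg p, norm_nonneg s]
  have hs : ‖s‖ ≤ n := by simp only [hn, tripleNorm]; linarith [norm_nonneg p, norm_nonneg h]
  have hn0 : 0 ≤ n := tripleNorm_nonneg _ _ _
  have hsm (a : ℝ) (ha : 0 ≤ a) (x : E) : ‖a • x‖ = a * ‖x‖ := by
    rw [norm_smul, Real.norm_eq_abs, abs_of_nonneg ha]
  set y := k • p + c • s with hy
  have hyn : ‖y‖ ≤ (k + c) * n := by
    refine (norm_add_le _ _).trans ?_
    rw [hsm k hk.le, hsm c hc.le]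
    nlinarith
  have hHy : ‖H y‖ ≤ M * (k + c) * n := (hH y).trans (by
    rw [mul_assoc]; exact mul_le_mul_of_nonneg_left hyn hM)
  have hKHy : ‖K (H y)‖ ≤ kb * (M * (k + c) * n) :=
    (hK _).trans (mul_le_mul_of_nonneg_left hHy hkb)
  have hz : ‖h - ε • H y‖ ≤ (1 + M * (k + c)) * n := by
    refine (norm_sub_le _ _).trans ?_
    rw [hsm ε hε.le]
    nlinarith [norm_nonneg (H y)]
  set z := K (h - ε • H y) with hzdef
  have hKz : ‖z‖ ≤ kb * (1 + M * (k + c)) * n := (hK _).trans (by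
    rw [mul_assoc]; exact mul_le_mul_of_nonneg_left hz hkb)
  set N := kb * (1 + M * (k + c)) with hN
  have hN0 : 0 ≤ N := by positivity
  have h1 : ‖rp - (ε ^ 2 / 2) • K (H y)‖ ≤ ‖rp‖ + ε ^ 2 / 2 * (kb * (M * (k + c) * n)) := by
    refine (norm_sub_le _ _).trans ?_
    rw [hsm _ (by positivity)]
    gcongr
  have h2 : ‖ε • ((1 / 2 : ℝ) • z) + rp‖ ≤ ε * (N + b) * n + ‖rp‖ := by
    refine (norm_add_le _ _).trans ?_
    rw [hsm _ hε.le, hsm _ (by norm_num), mul_assoc ε]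
    have : 1 / 2 * ‖z‖ ≤ (N + b) * n := by
      nlinarith [mul_nonneg hb.le hn0, mul_nonneg hN0 hn0]
    linarith [mul_le_mul_of_nonneg_left this hε.le]
  have h3 : ‖ε • ((1 / 2 : ℝ) • z - b • s) + rp‖ ≤ ε * (N + b) * n + ‖rp‖ := by
    refine (norm_add_le _ _).trans ?_
    rw [hsm _ hε.le, mul_assoc ε]
    have : ‖(1 / 2 : ℝ) • z - b • s‖ ≤ (N + b) * n := by
      refine (norm_sub_le _ _).trans ?_
      rw [hsm _ (by norm_num), hsm _ hb.le]
      nlinarith [mul_nonneg hN0 hn0, mul_le_mul_of_nonneg_left hs hb.le]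
    linarith [mul_le_mul_of_nonneg_left this hε.le]
  have h4 : ‖k • (ε • ((1 / 2 : ℝ) • z) + rp) + c • (ε • ((1 / 2 : ℝ) • z - b • s) + rp)‖ ≤
      (k + c) * (ε * (N + b) * n + ‖rp‖) := by
    refine (norm_add_le _ _).trans ?_
    rw [hsm _ hk.le, hsm _ hc.le, add_mul]
    gcongr
  have h5 : ‖rh + ε • H (k • (ε • ((1 / 2 : ℝ) • z) + rp)
      + c • (ε • ((1 / 2 : ℝ) • z - b • s) + rp))‖ ≤
      ‖rh‖ + ε * (M * ((k + c) * (ε * (N + b) * n + ‖rp‖))) := by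
    refine (norm_add_le _ _).trans ?_
    rw [hsm _ hε.le]
    gcongr
    exact (hH _).trans (mul_le_mul_of_nonneg_left h4 hM)
  have h6 : ε * (M * (k + c) * ‖rp‖) ≤ 1 * (M * (k + c) * ‖rp‖) := by gcongr
  have h7 : 0 ≤ M * (k + c) * ‖rh‖ := by positivity
  have h8 := norm_nonneg rh
  rw [tripleNorm]
  linarith

variable (E) in
/-- For small `ε` the Lyapunov function decays along the perturbed system in the averaging
coordinate, up to the contribution of the remainders `rp`, `rh`. -/
theorem exists_lyapFun_bounds_perturbed {g g' ka kb k c b M : ℝ} (hg : 0 < g) (hg' : 0 ≤ g')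
    (hka : 0 < ka) (hkb : 0 ≤ kb) (hk : 0 < k) (hc : 0 < c) (hb : 0 < b) (hM : 0 ≤ M) :
    ∃ κ a m C ε₀ : ℝ, 0 < a ∧ 0 < m ∧ 0 < C ∧ 0 < ε₀ ∧ ∀ ε : ℝ, 0 < ε → ε < ε₀ →
      ∀ K G : E →L[ℝ] E, (∀ x y, inner ℝ x (G y) = inner ℝ y (G x)) →
      (∀ x, g * ‖x‖ ^ 2 ≤ inner ℝ x (G x)) → (∀ x, ‖G x‖ ≤ g' * ‖x‖) →
      (∀ x, ka * ‖x‖ ^ 2 ≤ inner ℝ x (K x)) → (∀ x, ‖K x‖ ≤ kb * ‖x‖) →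
      ∀ p h s : E,
        a * tripleSq p h s ≤ lyapFun κ k c K G p h s ∧
        lyapFun κ k c K G p h s ≤ C * tripleNorm p h s ^ 2 ∧
        ∀ (H : E →L[ℝ] E) (rp rh p' h' s' z : E), (∀ x, ‖H x‖ ≤ M * ‖x‖) →
          z = h - ε • H (k • p + c • s) → p' = ε • ((1 / 2 : ℝ) • K z) + rp →
          s' = ε • ((1 / 2 : ℝ) • K z - b • s) + rp →
          h' = -(ε • G (k • p + c • s)) + rh + ε • H (k • p' + c • s') →
          lyapDeriv κ k c K G p h s p' h' s' ≤
            -(ε * m) * tripleSq p h s + C * tripleNorm p h s * (‖rp‖ + ‖rh‖) := by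
  obtain ⟨κ, a, m, C, ha, hm, hC, h⟩ := exists_lyapFun_bounds E hg hg' hka hkb hk hc hb
  set C₂ := M * (k + c) * (kb + kb * (1 + M * (k + c)) + b) with hC₂
  have hC₂0 : 0 ≤ C₂ := by positivity
  -- Half of the decay `m` pays for the error 3·C·C₂·ε² times `tripleSq`, the 3 coming from
  -- `sq_tripleNorm_le`. The `+ 1` guards against C₂ = 0.
  refine ⟨κ, a, m / 2, C * (2 + M * (k + c)), min 1 (m / (6 * C * (C₂ + 1))), ha, by positivity,
    by positivity, by positivity, ?_⟩
  intro ε hε hε₀ K G hGs hG hG' hK hK' p h₁ s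
  obtain ⟨h1, h2, h3, h4⟩ := h K G hGs hG hG' hK hK' p h₁ s
  have hn := tripleNorm_nonneg p h₁ s
  have hε1 : ε ≤ 1 := hε₀.le.trans (min_le_left _ _)
  refine ⟨h1, h2.trans ?_, ?_⟩
  · gcongr
    have : 0 ≤ M * (k + c) := by positivity
    nlinarith
  intro H rp rh p' h' s' z hH hz hp' hs' hh'
  set ep := rp - (ε ^ 2 / 2) • K (H (k • p + c • s)) with hep
  set eh := rh + ε • H (k • p' + c • s') with heh
  -- Rewriting the true momentum `z` through the averaging coordinate leaves an ε² term, which is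
  -- collected in `ep`; what remains is ε times the averaged system.
  have e1 : p' = ε • ((1 / 2 : ℝ) • K h₁) + ep := by
    rw [hp', hz, hep, map_sub, map_smul]; module
  have e2 : s' = ε • ((1 / 2 : ℝ) • K h₁ - b • s) + ep := by
    rw [hs', hz, hep, map_sub, map_smul]; module
  have e3 : h' = ε • (-G (k • p + c • s)) + eh := by rw [hh', heh]; module
  have herr : tripleNorm ep eh ep ≤ ε ^ 2 * C₂ * tripleNorm p h₁ s
      + (2 + M * (k + c)) * (‖rp‖ + ‖rh‖) := by
    rw [heh, hp', hs', hz]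
    exact tripleNorm_averaging_error_le hε hε1 hM hkb hk hc hb hK' hH p h₁ s rp rh
  have h5 := le_of_abs_le (h4 ep eh ep)
  rw [e1, e2, e3, lyapDeriv_add, lyapDeriv_smul]
  have h6 := mul_le_mul_of_nonneg_left h3 hε.le
  have h7 := mul_le_mul_of_nonneg_left herr (mul_nonneg hC.le hn)
  have h8 : C * ε ^ 2 * C₂ * tripleNorm p h₁ s ^ 2 ≤ ε * (m / 2) * tripleSq p h₁ s := by
    have hsq := sq_tripleNorm_le p h₁ s
    have hts : 0 ≤ tripleSq p h₁ s := by unfold tripleSq; positivity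
    have hε₂ : ε * (6 * C * (C₂ + 1)) ≤ m := by
      rw [← le_div_iff₀ (by positivity)]
      exact hε₀.le.trans (min_le_right _ _)
    calc C * ε ^ 2 * C₂ * tripleNorm p h₁ s ^ 2 ≤ C * ε ^ 2 * C₂ * (3 * tripleSq p h₁ s) := by
          gcongr
      _ = ε * tripleSq p h₁ s * (3 * C * C₂ * ε) := by ring
      _ ≤ ε * tripleSq p h₁ s * (m / 2) := by
          gcongr
          nlinarith [mul_pos hC hε]
      _ = ε * (m / 2) * tripleSq p h₁ s := by ring
  linarith

end Perturbed

/-! ### Quadratic forms of symmetric matrices. -/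

section Spectral

variable {n : Type*} [Fintype n] [DecidableEq n]

theorem inner_toEuclideanCLM_symm {A : Matrix n n ℝ} (hA : A.IsHermitian)
    (x y : EuclideanSpace ℝ n) :
    inner ℝ x (Matrix.toEuclideanCLM (𝕜 := ℝ) A y) =
      inner ℝ y (Matrix.toEuclideanCLM (𝕜 := ℝ) A x) := by
  have hT : Aᵀ = A := by
    rw [← Matrix.conjTranspose_eq_transpose_of_trivial]; exact hA
  rw [Matrix.inner_toEuclideanCLM, Matrix.inner_toEuclideanCLM, Matrix.dotProduct_mulVec,
    dotProduct_comm, ← Matrix.mulVec_transpose, hT]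

theorem inner_eigenvectorBasis_toEuclideanCLM {A : Matrix n n ℝ} (hA : A.IsHermitian) (i : n)
    (x : EuclideanSpace ℝ n) :
    inner ℝ (hA.eigenvectorBasis i) (Matrix.toEuclideanCLM (𝕜 := ℝ) A x) =
      hA.eigenvalues i * inner ℝ (hA.eigenvectorBasis i) x := by
  have h : Matrix.toEuclideanCLM (𝕜 := ℝ) A (hA.eigenvectorBasis i) =
      hA.eigenvalues i • hA.eigenvectorBasis i := by
    apply (WithLp.equiv 2 (n → ℝ)).injective
    exact hA.mulVec_eigenvectorBasis i
  rw [inner_toEuclideanCLM_symm hA, h, real_inner_smul_right, real_inner_comm]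

theorem inner_toEuclideanCLM_eq_sum {A : Matrix n n ℝ} (hA : A.IsHermitian)
    (x : EuclideanSpace ℝ n) :
    inner ℝ x (Matrix.toEuclideanCLM (𝕜 := ℝ) A x) =
      ∑ i, hA.eigenvalues i * inner ℝ (hA.eigenvectorBasis i) x ^ 2 := by
  rw [← hA.eigenvectorBasis.sum_inner_mul_inner]
  refine Finset.sum_congr rfl fun i _ => ?_
  rw [inner_eigenvectorBasis_toEuclideanCLM, real_inner_comm]
  ring

theorem norm_sq_eq_sum_inner {A : Matrix n n ℝ} (hA : A.IsHermitian) (x : EuclideanSpace ℝ n) :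
    ‖x‖ ^ 2 = ∑ i, inner ℝ (hA.eigenvectorBasis i) x ^ 2 := by
  rw [← hA.eigenvectorBasis.sum_sq_norm_inner_right x]
  simp

theorem le_inner_toEuclideanCLM {A : Matrix n n ℝ} (hA : A.IsHermitian) {l : ℝ}
    (hl : ∀ i, l ≤ hA.eigenvalues i) (x : EuclideanSpace ℝ n) :
    l * ‖x‖ ^ 2 ≤ inner ℝ x (Matrix.toEuclideanCLM (𝕜 := ℝ) A x) := by
  rw [inner_toEuclideanCLM_eq_sum hA, norm_sq_eq_sum_inner hA, Finset.mul_sum]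
  exact Finset.sum_le_sum fun i _ => mul_le_mul_of_nonneg_right (hl i) (sq_nonneg _)

theorem exists_le_inner_of_posDef {A : Matrix n n ℝ} (hA : A.PosDef) :
    ∃ g > 0, ∀ x, g * ‖x‖ ^ 2 ≤ inner ℝ x (Matrix.toEuclideanCLM (𝕜 := ℝ) A x) := by
  obtain ⟨g, hg, h⟩ : ∃ g > 0, ∀ i, g ≤ hA.1.eigenvalues i := by
    rcases isEmpty_or_nonempty n with hn | hn
    · exact ⟨1, one_pos, fun i => hn.elim i⟩
    · obtain ⟨j, hj⟩ := Finite.exists_min hA.1.eigenvalues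
      exact ⟨_, hA.eigenvalues_pos j, hj⟩
  exact ⟨g, hg, le_inner_toEuclideanCLM hA.1 h⟩

end Spectral

/-! ### Bounds on J⁻¹ uniform over admissible inertia matrices. -/

section Inertia

variable {Jmin Jmax : ℝ} {J : Matrix (Fin 3) (Fin 3) ℝ}

theorem AdmissibleInertia.isUnit_det (hJmin : 0 < Jmin) (hJ : AdmissibleInertia Jmin Jmax J) :
    IsUnit J.det := by
  obtain ⟨h, hb⟩ := hJ
  rw [isUnit_iff_ne_zero, h.det_eq_prod_eigenvalues]
  exact Finset.prod_ne_zero_iff.2 fun i _ => by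
    simpa using (hJmin.trans_le (hb i).1).ne'

theorem AdmissibleInertia.toEuclideanCLM_inv_apply (hJmin : 0 < Jmin)
    (hJ : AdmissibleInertia Jmin Jmax J) (x : EuclideanSpace ℝ (Fin 3)) :
    Matrix.toEuclideanCLM (𝕜 := ℝ) J⁻¹ (Matrix.toEuclideanCLM (𝕜 := ℝ) J x) = x ∧
      Matrix.toEuclideanCLM (𝕜 := ℝ) J (Matrix.toEuclideanCLM (𝕜 := ℝ) J⁻¹ x) = x := by
  rw [← mul_apply_eq_comp, ← map_mul, ← mul_apply_eq_comp, ← map_mul,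
    Matrix.nonsing_inv_mul _ (hJ.isUnit_det hJmin), Matrix.mul_nonsing_inv _ (hJ.isUnit_det hJmin),
    map_one]
  exact ⟨rfl, rfl⟩

theorem AdmissibleInertia.norm_inv_le (hJmin : 0 < Jmin) (hJ : AdmissibleInertia Jmin Jmax J)
    (x : EuclideanSpace ℝ (Fin 3)) :
    ‖Matrix.toEuclideanCLM (𝕜 := ℝ) J⁻¹ x‖ ≤ Jmin⁻¹ * ‖x‖ := by
  obtain ⟨-, hx⟩ := hJ.toEuclideanCLM_inv_apply hJmin x
  obtain ⟨h, hb⟩ := hJ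
  set y := Matrix.toEuclideanCLM (𝕜 := ℝ) J⁻¹ x
  have h1 := le_inner_toEuclideanCLM h (fun i => (hb i).1) y
  rw [hx] at h1
  have h2 := h1.trans (real_inner_le_norm y x)
  rw [← div_eq_inv_mul, le_div_iff₀ hJmin]
  rcases (norm_nonneg y).eq_or_lt with h0 | h0
  · rw [← h0, zero_mul]; exact norm_nonneg x
  · nlinarith

/-- With y = J⁻¹x this is ‖Jy‖² ≤ Jmax⟨y,Jy⟩, which in an eigenbasis of J is λᵢ² ≤ Jmax·λᵢ term by
term. -/
theorem AdmissibleInertia.le_inner_inv (hJmin : 0 < Jmin) (hJ : AdmissibleInertia Jmin Jmax J)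
    (x : EuclideanSpace ℝ (Fin 3)) :
    Jmax⁻¹ * ‖x‖ ^ 2 ≤ inner ℝ x (Matrix.toEuclideanCLM (𝕜 := ℝ) J⁻¹ x) := by
  obtain ⟨-, hx⟩ := hJ.toEuclideanCLM_inv_apply hJmin x
  obtain ⟨h, hb⟩ := hJ
  have hJmax : 0 < Jmax := hJmin.trans_le ((hb 0).1.trans (hb 0).2)
  set y := Matrix.toEuclideanCLM (𝕜 := ℝ) J⁻¹ x
  have hxy : inner ℝ x y = inner ℝ y (Matrix.toEuclideanCLM (𝕜 := ℝ) J y) := by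
    rw [hx, real_inner_comm]
  rw [hxy, ← div_eq_inv_mul, div_le_iff₀ hJmax, inner_toEuclideanCLM_eq_sum h, ← hx, norm_sq_eq_sum_inner h, Finset.sum_mul]
  refine Finset.sum_le_sum fun i _ => ?_
  rw [inner_eigenvectorBasis_toEuclideanCLM]
  have h0 : 0 ≤ h.eigenvalues i := hJmin.le.trans (hb i).1
  have h1 := mul_le_mul_of_nonneg_left (hb i).2 h0
  nlinarith [sq_nonneg (inner ℝ (h.eigenvectorBasis i) y : ℝ)]

theorem AdmissibleInertia.inner_inv_symm (hJ : AdmissibleInertia Jmin Jmax J)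
    (x y : EuclideanSpace ℝ (Fin 3)) :
    inner ℝ x (Matrix.toEuclideanCLM (𝕜 := ℝ) J⁻¹ y) =
      inner ℝ y (Matrix.toEuclideanCLM (𝕜 := ℝ) J⁻¹ x) :=
  inner_toEuclideanCLM_symm hJ.1.inv x y

end Inertia

/-! ### Bounded operator-valued primitive of Γ − Γav. -/

section Primitive

/-- A bounded primitive of the deviation of a matrix function from its average, as a family of
operators. -/
theorem exists_bounded_primitive {Γ : ℝ → Matrix (Fin 3) (Fin 3) ℝ} {Γav : Matrix (Fin 3) (Fin 3) ℝ}
    (hΓ : ∀ i j, Continuous fun t => Γ t i j)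
    (hb : ∀ i j, ∃ M, ∀ T, |∫ τ in (0 : ℝ)..T, (Γ τ i j - Γav i j)| ≤ M) :
    ∃ (M : ℝ) (H : ℝ → EuclideanSpace ℝ (Fin 3) →L[ℝ] EuclideanSpace ℝ (Fin 3)), 0 ≤ M ∧
      (∀ t, ‖H t‖ ≤ M) ∧ ∀ t, HasDerivAt H (Matrix.toEuclideanCLM (𝕜 := ℝ) (Γ t) -
        Matrix.toEuclideanCLM (𝕜 := ℝ) Γav) t := by
  choose M hM using hb
  -- Expanding in matrix units reduces bound and derivative to the scalar entries.
  let S (i j : Fin 3) : EuclideanSpace ℝ (Fin 3) →L[ℝ] EuclideanSpace ℝ (Fin 3) :=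
    Matrix.toEuclideanCLM (𝕜 := ℝ) (Matrix.single i j 1)
  have hM0 (i j : Fin 3) : 0 ≤ M i j := (abs_nonneg _).trans (hM i j 0)
  refine ⟨∑ i, ∑ j, M i j * ‖S i j‖,
    fun t => ∑ i, ∑ j, (∫ τ in (0 : ℝ)..t, (Γ τ i j - Γav i j)) • S i j, ?_, ?_, ?_⟩
  · exact Finset.sum_nonneg fun i _ => Finset.sum_nonneg fun j _ =>
      mul_nonneg (hM0 i j) (norm_nonneg _)
  · intro t
    refine (norm_sum_le _ _).trans (Finset.sum_le_sum fun i _ =>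
      (norm_sum_le _ _).trans (Finset.sum_le_sum fun j _ => ?_))
    rw [norm_smul]
    exact mul_le_mul_of_nonneg_right (hM i j t) (norm_nonneg _)
  · intro t
    have h : Matrix.toEuclideanCLM (𝕜 := ℝ) (Γ t) - Matrix.toEuclideanCLM (𝕜 := ℝ) Γav =
        ∑ i, ∑ j, (Γ t i j - Γav i j) • S i j := by
      rw [← map_sub, Matrix.matrix_eq_sum_single (Γ t - Γav)]
      simp only [map_sum]
      refine Finset.sum_congr rfl fun i _ => Finset.sum_congr rfl fun j _ => ?_
      rw [← map_smul, Matrix.smul_single, smul_eq_mul, mul_one, Matrix.sub_apply]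
    rw [h]
    refine HasDerivAt.fun_sum fun i _ => HasDerivAt.fun_sum fun j _ => ?_
    have hij : Continuous fun τ => Γ τ i j - Γav i j := (hΓ i j).sub continuous_const
    exact (intervalIntegral.integral_hasDerivAt_right (hij.intervalIntegrable 0 t)
      (hij.stronglyMeasurableAtFilter _ _) hij.continuousAt).smul_const (S i j)

end Primitive

/-! ### Smoothness of the closed loop in state and field matrix. -/

section Smoothness

variable {S : Type*} [NormedAddCommGroup S] [NormedSpace ℝ S] {l m n : Type*} [Fintype m]
  {N : WithTop ℕ∞}

theorem contDiff_mulVec {A : S → Matrix l m ℝ} {v : S → m → ℝ}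
    (hA : ∀ i j, ContDiff ℝ N fun x => A x i j) (hv : ∀ j, ContDiff ℝ N fun x => v x j) (i : l) :
    ContDiff ℝ N fun x => (A x *ᵥ v x) i :=
  ContDiff.sum fun j _ => (hA i j).mul (hv j)

theorem contDiff_matrix_mul {A : S → Matrix l m ℝ} {B : S → Matrix m n ℝ}
    (hA : ∀ i j, ContDiff ℝ N fun x => A x i j) (hB : ∀ i j, ContDiff ℝ N fun x => B x i j)
    (i : l) (j : n) : ContDiff ℝ N fun x => (A x * B x) i j := by
  simp only [Matrix.mul_apply]
  exact ContDiff.sum fun k _ => (hA i k).mul (hB k j)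

variable {q : S → Fin 4 → ℝ}

theorem contDiff_skew {a : S → Fin 3 → ℝ} (ha : ∀ j, ContDiff ℝ N fun x => a x j) (i j : Fin 3) :
    ContDiff ℝ N fun x => skew (a x) i j := by
  fin_cases i <;> fin_cases j <;>
    first
    | exact ha _
    | exact (ha _).neg
    | exact contDiff_const

theorem contDiff_vecPart (hq : ∀ j, ContDiff ℝ N fun x => q x j) (i : Fin 3) :
    ContDiff ℝ N fun x => vecPart (q x) i := by
  fin_cases i <;> exact hq _

theorem contDiff_kinMatrix (hq : ∀ j, ContDiff ℝ N fun x => q x j) (i : Fin 4) (j : Fin 3) :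
    ContDiff ℝ N fun x => kinMatrix (q x) i j := by
  fin_cases i <;> fin_cases j <;>
    first
    | exact contDiff_const.mul (hq _)
    | exact contDiff_const.mul (hq _).neg

theorem contDiff_attitude (hq : ∀ j, ContDiff ℝ N fun x => q x j) (i j : Fin 3) :
    ContDiff ℝ N fun x => attitude (q x) i j := by
  have hv := contDiff_vecPart hq
  refine ((ContDiff.mul ?_ contDiff_const).add
    (contDiff_const.mul ((hv i).mul (hv j)))).sub
    ((contDiff_const.mul (hq 3)).mul (contDiff_skew hv i j))
  exact ((hq 3).pow 2).sub (ContDiff.sum fun k _ => (hv k).mul (hv k))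

theorem contDiff_controlLaw (k₁ k₂ α lam ε : ℝ) {δ : S → Fin 4 → ℝ}
    (hq : ∀ j, ContDiff ℝ N fun x => q x j) (hδ : ∀ j, ContDiff ℝ N fun x => δ x j) (i : Fin 3) :
    ContDiff ℝ N fun x => controlLaw k₁ k₂ α lam ε (q x) (δ x) i := by
  refine (contDiff_const.mul ((contDiff_const.mul (contDiff_vecPart hq i)).add
    (contDiff_const.mul ?_))).neg
  exact contDiff_mulVec (A := fun x => (kinMatrix (q x))ᵀ)
    (fun i j => contDiff_kinMatrix hq j i) (fun j => (hq j).sub (contDiff_const.mul (hδ j))) i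

/-- The closed loop is smooth in the state and in the value of the matrix `Γ`. -/
theorem contDiff_closedLoop (J : Matrix (Fin 3) (Fin 3) ℝ) (k₁ k₂ α lam ε : ℝ) :
    ContDiff ℝ N fun z : (Fin 3 → Fin 3 → ℝ) × State =>
      closedLoop J (fun _ => Matrix.of z.1) k₁ k₂ α lam ε 0 z.2 := by
  have hq (j : Fin 4) : ContDiff ℝ N
      fun z : (Fin 3 → Fin 3 → ℝ) × State => (z.2.1 : Fin 4 → ℝ) j := by fun_prop
  have hω (j : Fin 3) : ContDiff ℝ N
      fun z : (Fin 3 → Fin 3 → ℝ) × State => (z.2.2.1 : Fin 3 → ℝ) j := by fun_prop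
  have hδ (j : Fin 4) : ContDiff ℝ N
      fun z : (Fin 3 → Fin 3 → ℝ) × State => (z.2.2.2 : Fin 4 → ℝ) j := by fun_prop
  have hG (i j : Fin 3) : ContDiff ℝ N
      fun z : (Fin 3 → Fin 3 → ℝ) × State => Matrix.of z.1 i j := by
    simp only [Matrix.of_apply]; fun_prop
  have hA := contDiff_attitude hq
  refine ContDiff.prodMk ?_ (ContDiff.prodMk ?_ ?_) <;>
    refine contDiff_euclidean.2 fun i => ?_
  · exact contDiff_mulVec (contDiff_kinMatrix hq) hω i
  · refine contDiff_mulVec (A := fun _ => J⁻¹) (fun _ _ => contDiff_const) (fun k => ?_) i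
    refine (contDiff_mulVec (contDiff_skew hω)
      (contDiff_mulVec (A := fun _ => J) (fun _ _ => contDiff_const) hω) k).neg.add ?_
    exact contDiff_mulVec (contDiff_matrix_mul (contDiff_matrix_mul hA hG)
      (fun i j => hA j i)) (contDiff_controlLaw k₁ k₂ α lam ε hq hδ) k
  · exact contDiff_const.mul ((hq i).sub (contDiff_const.mul (hδ i)))

end Smoothness

/-! ### Nonlinear remainders, uniformly in time. -/

section Remainder

open Asymptotics

variable {ι F l m : Type*} [NormedAddCommGroup F] {f : Filter ι} {D : ι → F} [Fintype m]

theorem isLittleO_mulVec {A : ι → Matrix l m ℝ} {v : ι → m → ℝ}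
    (hA : ∀ i j, (fun x => A x i j) =o[f] fun _ => (1 : ℝ)) (hv : ∀ j, (fun x => v x j) =O[f] D)
    (i : l) : (fun x => (A x *ᵥ v x) i) =o[f] D := by
  simp only [Matrix.mulVec, dotProduct]
  refine IsLittleO.fun_sum fun j _ => ?_
  have h := (hA i j).mul_isBigO (hv j).norm_right
  simpa using h

theorem isLittleO_mulVec' {A : ι → Matrix l m ℝ} {v : ι → m → ℝ}
    (hA : ∀ i j, (fun x => A x i j) =O[f] fun _ => (1 : ℝ)) (hv : ∀ j, (fun x => v x j) =o[f] D)
    (i : l) : (fun x => (A x *ᵥ v x) i) =o[f] D := by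
  simp only [Matrix.mulVec, dotProduct]
  refine IsLittleO.fun_sum fun j _ => ?_
  have h := (hA i j).mul_isLittleO (hv j).norm_right
  simpa using h

theorem isBigO_mulVec {A : ι → Matrix l m ℝ} {v : ι → m → ℝ}
    (hA : ∀ i j, (fun x => A x i j) =O[f] fun _ => (1 : ℝ)) (hv : ∀ j, (fun x => v x j) =O[f] D)
    (i : l) : (fun x => (A x *ᵥ v x) i) =O[f] D := by
  simp only [Matrix.mulVec, dotProduct]
  refine IsBigO.fun_sum fun j _ => ?_
  have h := (hA i j).mul (hv j).norm_right
  simpa using h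

theorem isLittleO_toLp {n : Type*} [Fintype n] {v : ι → n → ℝ}
    (hv : ∀ j, (fun x => v x j) =o[f] D) :
    (fun x => (WithLp.toLp 2 (v x) : EuclideanSpace ℝ n)) =o[f] D :=
  ((PiLp.continuousLinearEquiv 2 ℝ fun _ : n => ℝ).symm.toContinuousLinearMap.isBigO_comp
    v f).trans_isLittleO (isLittleO_pi.2 hv)

variable {xe : State}

/-- The filter `⊤` on the time factor makes every estimate along `⊤ ×ˢ 𝓝 xe` uniform in time. -/
theorem isLittleO_one_of_contDiff {φ : State → ℝ} (hφ : ContDiff ℝ 1 φ) (h0 : φ xe = 0) :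
    (fun z : ℝ × State => φ z.2) =o[⊤ ×ˢ 𝓝 xe] fun _ => (1 : ℝ) := by
  rw [isLittleO_one_iff]
  have h := hφ.continuous.tendsto xe
  rw [h0] at h
  exact h.comp tendsto_snd

theorem isBigO_sub_of_contDiff {φ : State → ℝ} (hφ : ContDiff ℝ 1 φ) (h0 : φ xe = 0) :
    (fun z : ℝ × State => φ z.2) =O[⊤ ×ˢ 𝓝 xe] fun z => z.2 - xe := by
  have h := (hφ.differentiable one_ne_zero xe).isBigO_sub
  simp only [h0, sub_zero] at h
  exact h.comp_tendsto tendsto_snd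

theorem isBigO_one_of_contDiff {φ : State → ℝ} (hφ : ContDiff ℝ 1 φ) :
    (fun z : ℝ × State => φ z.2) =O[⊤ ×ˢ 𝓝 xe] fun _ => (1 : ℝ) :=
  ((hφ.continuous.tendsto xe).comp tendsto_snd).isBigO_one ℝ

/-- The equilibrium `(q̄, 0, q̄ / (ε λ))` of the closed loop. -/
def equilibrium (lam ε : ℝ) : State := (qbar, 0, (1 / (ε * lam)) • qbar)

/-- The vector part of a quaternion as a continuous linear map. -/
def vecCLM : EuclideanSpace ℝ (Fin 4) →L[ℝ] EuclideanSpace ℝ (Fin 3) :=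
  LinearMap.toContinuousLinearMap
    { toFun := fun q => WithLp.toLp 2 (vecPart q)
      map_add' := fun p q => by ext i; fin_cases i <;> rfl
      map_smul' := fun a q => by ext i; fin_cases i <;> rfl }

theorem vecCLM_apply (q : EuclideanSpace ℝ (Fin 4)) : vecCLM q = WithLp.toLp 2 (vecPart q) := rfl

theorem vecCLM_qbar : vecCLM qbar = 0 := by
  ext i; fin_cases i <;> rfl

theorem norm_sq_eq_vecCLM (q : EuclideanSpace ℝ (Fin 4)) : ‖q‖ ^ 2 = ‖vecCLM q‖ ^ 2 + q 3 ^ 2 := by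
  simp [EuclideanSpace.norm_sq_eq, vecCLM_apply, vecPart, Fin.sum_univ_succ]
  ring

/-- The remainder of the kinematics at the target. -/
def kinRem (q : Fin 4 → ℝ) : Matrix (Fin 4) (Fin 3) ℝ := kinMatrix q - kinMatrix qbar

/-- The remainder of the attitude kinematics. -/
def attitudeRem (x : State) : EuclideanSpace ℝ (Fin 3) :=
  vecCLM (WithLp.toLp 2 (kinRem x.1 *ᵥ (x.2.1 : Fin 3 → ℝ)))

/-- The remainder of the angular momentum equation. -/
def momentumRem (J : Matrix (Fin 3) (Fin 3) ℝ) (Γ : ℝ → Matrix (Fin 3) (Fin 3) ℝ)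
    (k₁ k₂ α lam ε : ℝ) (t : ℝ) (x : State) : EuclideanSpace ℝ (Fin 3) :=
  WithLp.toLp 2 ((1 / ε) • (-(skew x.2.1 *ᵥ (J *ᵥ (x.2.1 : Fin 3 → ℝ)))
    + (attitude x.1 - 1) *ᵥ (Γ t *ᵥ ((attitude x.1)ᵀ *ᵥ controlLaw k₁ k₂ α lam ε x.1 x.2.2))
    + Γ t *ᵥ (((attitude x.1)ᵀ - 1) *ᵥ controlLaw k₁ k₂ α lam ε x.1 x.2.2)
    - (ε ^ 2 * (k₂ * α * lam)) •
      (Γ t *ᵥ ((kinRem x.1)ᵀ *ᵥ ((x.1 : Fin 4 → ℝ) - (ε * lam) • (x.2.2 : Fin 4 → ℝ))))))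

theorem isLittleO_const_smul_apply {n : Type*} (c : ℝ) {v : ι → n → ℝ}
    (hv : ∀ j, (fun x => v x j) =o[f] D) (j : n) : (fun x => (c • v x) j) =o[f] D :=
  (hv j).const_mul_left c

theorem kinRem_qbar : kinRem qbar = 0 := sub_self _

theorem contDiff_kinRem (i : Fin 4) (j : Fin 3) :
    ContDiff ℝ 1 fun x : State => kinRem x.1 i j :=
  (contDiff_kinMatrix (fun j => by fun_prop) i j).sub contDiff_const

theorem attitude_qbar : attitude qbar = 1 := by
  ext i j
  fin_cases i <;> fin_cases j <;>
    simp [attitude, qbar, vecPart, skew, dotProduct, Fin.sum_univ_three]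

theorem controlLaw_equilibrium {k₁ k₂ α lam ε : ℝ} (hε : ε ≠ 0) (hlam : lam ≠ 0) :
    controlLaw k₁ k₂ α lam ε qbar ((1 / (ε * lam)) • qbar : EuclideanSpace ℝ (Fin 4)) = 0 := by
  have h1 : vecPart qbar = 0 := by ext i; fin_cases i <;> rfl
  have h2 : (qbar : Fin 4 → ℝ) -
      (ε * lam) • (((1 / (ε * lam)) • qbar : EuclideanSpace ℝ (Fin 4)) : Fin 4 → ℝ) = 0 := by
    rw [WithLp.ofLp_smul, smul_smul, mul_one_div_cancel (mul_ne_zero hε hlam), one_smul, sub_self]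
  rw [controlLaw, h1, h2]
  simp

theorem isLittleO_attitudeRem (lam ε : ℝ) :
    (fun z : ℝ × State => attitudeRem z.2) =o[⊤ ×ˢ 𝓝 (equilibrium lam ε)]
      fun z => z.2 - equilibrium lam ε := by
  refine (vecCLM.isBigO_comp _ _).trans_isLittleO (isLittleO_toLp fun j => ?_)
  refine isLittleO_mulVec (A := fun z : ℝ × State => kinRem z.2.1)
    (v := fun z : ℝ × State => (z.2.2.1 : Fin 3 → ℝ)) (fun i j => ?_) (fun j => ?_) j
  · refine isLittleO_one_of_contDiff (contDiff_kinRem i j) ?_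
    simp [equilibrium, kinRem_qbar]
  · exact isBigO_sub_of_contDiff (φ := fun x : State => x.2.1 j) (by fun_prop) (by simp [equilibrium])

/-- Each of the four terms contains a factor that vanishes at the equilibrium (ω^×, A − 1, Aᵀ − 1,
`kinRem`) and a second one that is O of the distance; of Γ only boundedness is used. -/
theorem isLittleO_momentumRem (J : Matrix (Fin 3) (Fin 3) ℝ)
    {Γ : ℝ → Matrix (Fin 3) (Fin 3) ℝ} (hΓ : ∀ i j, ∃ M, ∀ t, |Γ t i j| ≤ M)
    (k₁ k₂ α : ℝ) {lam ε : ℝ} (hε : ε ≠ 0) (hlam : lam ≠ 0) :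
    (fun z : ℝ × State => momentumRem J Γ k₁ k₂ α lam ε z.1 z.2)
      =o[⊤ ×ˢ 𝓝 (equilibrium lam ε)] fun z => z.2 - equilibrium lam ε := by
  have hΓO (i j : Fin 3) : (fun z : ℝ × State => Γ z.1 i j)
      =O[⊤ ×ˢ 𝓝 (equilibrium lam ε)] fun _ => (1 : ℝ) := by
    obtain ⟨M, hM⟩ := hΓ i j
    exact isBigO_of_le' (c := M) _ fun z => by simpa using hM z.1
  have hq (j : Fin 4) : ContDiff ℝ 1 fun x : State => (x.1 : Fin 4 → ℝ) j := by fun_prop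
  have hω (j : Fin 3) : ContDiff ℝ 1 fun x : State => (x.2.1 : Fin 3 → ℝ) j := by fun_prop
  have hδ (j : Fin 4) : ContDiff ℝ 1 fun x : State => (x.2.2 : Fin 4 → ℝ) j := by fun_prop
  have hu (j : Fin 3) := isBigO_sub_of_contDiff (xe := equilibrium lam ε)
    (contDiff_controlLaw k₁ k₂ α lam ε hq hδ j)
    (by simpa [equilibrium] using congrFun (controlLaw_equilibrium hε hlam) j)
  have hA (i j : Fin 3) : (fun z : ℝ × State => (attitude z.2.1 - 1) i j)
      =o[⊤ ×ˢ 𝓝 (equilibrium lam ε)] fun _ => (1 : ℝ) :=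
    isLittleO_one_of_contDiff (φ := fun x => (attitude x.1 - 1) i j)
      ((contDiff_attitude hq i j).sub contDiff_const) (by simp [equilibrium, attitude_qbar])
  have hAT (i j : Fin 3) : (fun z : ℝ × State => ((attitude z.2.1)ᵀ - 1) i j)
      =o[⊤ ×ˢ 𝓝 (equilibrium lam ε)] fun _ => (1 : ℝ) :=
    isLittleO_one_of_contDiff (φ := fun x => ((attitude x.1)ᵀ - 1) i j)
      ((contDiff_attitude hq j i).sub contDiff_const) (by simp [equilibrium, attitude_qbar])
  refine isLittleO_toLp (isLittleO_const_smul_apply _ fun i => ?_)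
  refine IsLittleO.sub (IsLittleO.add (IsLittleO.add (IsLittleO.neg_left ?_) ?_) ?_)
    (isLittleO_const_smul_apply _ (fun i => ?_) i)
  · refine isLittleO_mulVec (A := fun z : ℝ × State => skew z.2.2.1)
      (v := fun z : ℝ × State => J *ᵥ (z.2.2.1 : Fin 3 → ℝ)) (fun i j => ?_) (fun j => ?_) i
    · refine isLittleO_one_of_contDiff (contDiff_skew hω i j) ?_
      fin_cases i <;> fin_cases j <;> simp [equilibrium, skew]
    · exact isBigO_sub_of_contDiff (contDiff_mulVec (A := fun _ : State => J) (fun _ _ => contDiff_const) hω j)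
        (by simp [equilibrium])
  · exact isLittleO_mulVec hA (isBigO_mulVec hΓO (isBigO_mulVec (fun i j =>
      isBigO_one_of_contDiff (contDiff_attitude hq j i)) hu)) i
  · exact isLittleO_mulVec' hΓO (isLittleO_mulVec hAT hu) i
  · refine isLittleO_mulVec' hΓO (isLittleO_mulVec
      (A := fun z : ℝ × State => (kinRem z.2.1)ᵀ) (fun i j => ?_) (fun j => ?_)) i
    · refine isLittleO_one_of_contDiff (contDiff_kinRem j i) ?_
      simp [equilibrium, kinRem_qbar]
    · refine isBigO_sub_of_contDiff ((hq j).sub (contDiff_const.mul (hδ j))) ?_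
      simp [equilibrium]
      field_simp
      ring

end Remainder

/-! ### The closed loop in slow coordinates. -/

section Coordinates

/-- The attitude error `q_v`. -/
def attCoord (x : State) : EuclideanSpace ℝ (Fin 3) := vecCLM x.1

/-- The angular momentum `J ω / ε` in slow time. -/
def momCoord (J : Matrix (Fin 3) (Fin 3) ℝ) (ε : ℝ) (x : State) : EuclideanSpace ℝ (Fin 3) :=
  (1 / ε) • Matrix.toEuclideanCLM (𝕜 := ℝ) J x.2.1

/-- The vector part of the filter error `q - ε λ δ`. -/
def filtCoord (lam ε : ℝ) (x : State) : EuclideanSpace ℝ (Fin 3) :=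
  vecCLM (x.1 - (ε * lam) • x.2.2)

/-- The deviation of the scalar part of the filter state. -/
def scalCoord (lam ε : ℝ) (x : State) : ℝ := x.2.2 3 - 1 / (ε * lam)

/-- The linear part of the control law. -/
def feedback (k c lam ε : ℝ) (x : State) : EuclideanSpace ℝ (Fin 3) :=
  k • attCoord x + c • filtCoord lam ε x

/-- The angular momentum corrected by the averaging term. -/
def avgMom (J : Matrix (Fin 3) (Fin 3) ℝ)
    (H : ℝ → EuclideanSpace ℝ (Fin 3) →L[ℝ] EuclideanSpace ℝ (Fin 3)) (k c lam ε t : ℝ)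
    (x : State) : EuclideanSpace ℝ (Fin 3) :=
  momCoord J ε x + ε • H t (feedback k c lam ε x)

theorem vecCLM_kinMatrix_qbar (w : EuclideanSpace ℝ (Fin 3)) :
    vecCLM (WithLp.toLp 2 (kinMatrix qbar *ᵥ (w : Fin 3 → ℝ))) = (1 / 2 : ℝ) • w := by
  ext i
  fin_cases i <;>
    simp [vecCLM_apply, vecPart, kinMatrix, qbar, dotProduct, Fin.sum_univ_three]

theorem kinMatrix_qbar_transpose_mulVec (z : Fin 4 → ℝ) :
    (kinMatrix qbar)ᵀ *ᵥ z = (1 / 2 : ℝ) • vecPart z := by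
  ext i
  fin_cases i <;>
    simp [vecPart, kinMatrix, qbar, Matrix.mulVec, dotProduct, Fin.sum_univ_four]

/-- Infinitesimal form of the invariance of the unit sphere: ‖q‖² is a first integral. -/
theorem dotProduct_kinMatrix_mulVec (q : Fin 4 → ℝ) (w : Fin 3 → ℝ) :
    q ⬝ᵥ (kinMatrix q *ᵥ w) = 0 := by
  simp [kinMatrix, Matrix.mulVec, dotProduct, Fin.sum_univ_three, Fin.sum_univ_four]
  ring

variable {J : Matrix (Fin 3) (Fin 3) ℝ} {Γ : ℝ → Matrix (Fin 3) (Fin 3) ℝ}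
  {k₁ k₂ α lam ε : ℝ}

theorem vecCLM_closedLoop_fst {Jmin Jmax : ℝ} (hJmin : 0 < Jmin)
    (hJ : AdmissibleInertia Jmin Jmax J) (hε : ε ≠ 0) (t : ℝ) (x : State) :
    vecCLM (closedLoop J Γ k₁ k₂ α lam ε t x).1 =
      ε • ((1 / 2 : ℝ) • Matrix.toEuclideanCLM (𝕜 := ℝ) J⁻¹ (momCoord J ε x)) + attitudeRem x := by
  rw [momCoord, map_smul, (hJ.toEuclideanCLM_inv_apply hJmin x.2.1).1, attitudeRem, kinRem,
    Matrix.sub_mulVec, WithLp.toLp_sub, map_sub, vecCLM_kinMatrix_qbar, smul_smul, smul_smul,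
    show ε * (1 / 2) * (1 / ε) = 1 / 2 by field_simp]
  change vecCLM (WithLp.toLp 2 (kinMatrix x.1 *ᵥ (x.2.1 : Fin 3 → ℝ))) = _
  abel

theorem vecCLM_closedLoop_filter (t : ℝ) (x : State) :
    vecCLM (closedLoop J Γ k₁ k₂ α lam ε t x).2.2 = α • filtCoord lam ε x := by
  rw [filtCoord, ← map_smul]
  rfl

theorem closedLoop_scalar (hε : ε ≠ 0) (hlam : lam ≠ 0) (t : ℝ) (x : State) :
    (closedLoop J Γ k₁ k₂ α lam ε t x).2.2 3 =
      -(ε * (α * lam)) * scalCoord lam ε x + α * (x.1 3 - 1) := by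
  change α * (x.1 3 - (ε * lam) * x.2.2 3) = _
  rw [scalCoord]
  field_simp
  ring

/-- W(q̄)ᵀ is half of the vector part, which is where the gain k₂αλ/2 comes from; the term in
`kinRem` is of second order at the equilibrium. -/
theorem controlLaw_eq (q δ : EuclideanSpace ℝ (Fin 4)) (w : EuclideanSpace ℝ (Fin 3)) :
    controlLaw k₁ k₂ α lam ε q δ =
      -(ε ^ 2 • (feedback k₁ (k₂ * α * lam / 2) lam ε (q, w, δ) : Fin 3 → ℝ))
        - (ε ^ 2 * (k₂ * α * lam)) •
          ((kinRem q)ᵀ *ᵥ ((q : Fin 4 → ℝ) - (ε * lam) • (δ : Fin 4 → ℝ))) := by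
  have h : (feedback k₁ (k₂ * α * lam / 2) lam ε (q, w, δ) : Fin 3 → ℝ) =
      k₁ • vecPart q + (k₂ * α * lam / 2) •
        vecPart ((q : Fin 4 → ℝ) - (ε * lam) • (δ : Fin 4 → ℝ)) := rfl
  rw [h, kinRem, Matrix.transpose_sub, Matrix.sub_mulVec, kinMatrix_qbar_transpose_mulVec,
    controlLaw]
  module

/-- The splitting is AΓAᵀu = Γu + (A − 1)ΓAᵀu + Γ(Aᵀ − 1)u. The ε² of the control, divided by the ε
of the momentum scaling, leaves the slow rate ε. -/
theorem toEuclideanCLM_closedLoop_momentum {Jmin Jmax : ℝ} (hJmin : 0 < Jmin)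
    (hJ : AdmissibleInertia Jmin Jmax J) (hε : ε ≠ 0) (t : ℝ) (x : State) :
    (1 / ε) • Matrix.toEuclideanCLM (𝕜 := ℝ) J (closedLoop J Γ k₁ k₂ α lam ε t x).2.1 =
      -(ε • Matrix.toEuclideanCLM (𝕜 := ℝ) (Γ t) (feedback k₁ (k₂ * α * lam / 2) lam ε x))
        + momentumRem J Γ k₁ k₂ α lam ε t x := by
  apply (WithLp.equiv 2 (Fin 3 → ℝ)).injective
  change (1 / ε) • (J *ᵥ (J⁻¹ *ᵥ (-(skew x.2.1 *ᵥ (J *ᵥ (x.2.1 : Fin 3 → ℝ)))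
      + (attitude x.1 * Γ t * (attitude x.1)ᵀ) *ᵥ controlLaw k₁ k₂ α lam ε x.1 x.2.2))) =
    -(ε • (Γ t *ᵥ (feedback k₁ (k₂ * α * lam / 2) lam ε x : Fin 3 → ℝ)))
      + (1 / ε) • (-(skew x.2.1 *ᵥ (J *ᵥ (x.2.1 : Fin 3 → ℝ)))
    + (attitude x.1 - 1) *ᵥ (Γ t *ᵥ ((attitude x.1)ᵀ *ᵥ controlLaw k₁ k₂ α lam ε x.1 x.2.2))
    + Γ t *ᵥ (((attitude x.1)ᵀ - 1) *ᵥ controlLaw k₁ k₂ α lam ε x.1 x.2.2)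
    - (ε ^ 2 * (k₂ * α * lam)) •
      (Γ t *ᵥ ((kinRem x.1)ᵀ *ᵥ ((x.1 : Fin 4 → ℝ) - (ε * lam) • (x.2.2 : Fin 4 → ℝ)))))
  have hu := congrArg (Γ t *ᵥ ·) (controlLaw_eq (k₁ := k₁) (k₂ := k₂) (α := α) (lam := lam)
    (ε := ε) x.1 x.2.2 x.2.1)
  set z := (x.1 : Fin 4 → ℝ) - (ε * lam) • (x.2.2 : Fin 4 → ℝ)
  simp only [Matrix.mulVec_sub, Matrix.mulVec_neg, Matrix.mulVec_smul] at hu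
  set Y := Γ t *ᵥ (feedback k₁ (k₂ * α * lam / 2) lam ε x : Fin 3 → ℝ) with hY
  rw [Matrix.mulVec_mulVec, Matrix.mul_nonsing_inv _ (hJ.isUnit_det hJmin), Matrix.one_mulVec,
    Matrix.sub_mulVec, Matrix.sub_mulVec, Matrix.mulVec_sub, Matrix.one_mulVec, Matrix.one_mulVec,
    ← Matrix.mulVec_mulVec, ← Matrix.mulVec_mulVec, hu]
  have he : ε • Y = (1 / ε) • (ε ^ 2 • Y) := by rw [smul_smul]; congr 1; field_simp
  rw [he, hY]
  module

end Coordinates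

/-! ### Lyapunov coordinates versus distance to the equilibrium. -/

section Comparison

theorem one_sub_scalar_eq {x : State} (hx : x ∈ stateSpace) :
    x.1 3 - 1 = -(‖x.1 - qbar‖ ^ 2 / 2) := by
  have h1 : ‖x.1‖ ^ 2 = 1 := by
    have : ‖x.1‖ = 1 := hx
    rw [this]; norm_num
  rw [EuclideanSpace.real_norm_sq_eq, Fin.sum_univ_four] at h1 ⊢
  simp [qbar]
  linarith

/-- On the sphere d = ‖q − q̄‖ satisfies d² = ‖q_v‖² + d⁴/4. The bound d ≤ 1 excludes −q̄, where q_v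
vanishes as well. -/
theorem norm_attitude_sub_sq_le {x : State} (hx : x ∈ stateSpace) (h1 : ‖x.1 - qbar‖ ≤ 1) :
    ‖x.1 - qbar‖ ^ 2 ≤ 2 * ‖attCoord x‖ ^ 2 := by
  have h2 := norm_sq_eq_vecCLM (x.1 - qbar)
  have h3 : (x.1 - qbar) 3 = x.1 3 - 1 := by simp [qbar]
  rw [map_sub, vecCLM_qbar, sub_zero, h3, one_sub_scalar_eq hx] at h2
  have h4 : ‖x.1 - qbar‖ ^ 2 ≤ 1 := pow_le_one₀ (norm_nonneg _) h1
  rw [attCoord]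
  nlinarith [sq_nonneg ‖x.1 - qbar‖]

theorem norm_vecCLM_le (q : EuclideanSpace ℝ (Fin 4)) : ‖vecCLM q‖ ≤ ‖q‖ := by
  have := norm_sq_eq_vecCLM q
  exact (sq_le_sq₀ (norm_nonneg _) (norm_nonneg _)).1 (by nlinarith [sq_nonneg (q 3)])

theorem abs_apply_three_le (q : EuclideanSpace ℝ (Fin 4)) : |q 3| ≤ ‖q‖ := by
  simpa using PiLp.norm_apply_le q 3

variable {J : Matrix (Fin 3) (Fin 3) ℝ}
  {H : ℝ → EuclideanSpace ℝ (Fin 3) →L[ℝ] EuclideanSpace ℝ (Fin 3)} {k c lam ε M : ℝ}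

theorem norm_sub_equilibrium_components (x : State) :
    ‖x.1 - qbar‖ ≤ ‖x - equilibrium lam ε‖ ∧ ‖x.2.1‖ ≤ ‖x - equilibrium lam ε‖ ∧
      ‖x.2.2 - (1 / (ε * lam)) • qbar‖ ≤ ‖x - equilibrium lam ε‖ := by
  refine ⟨norm_fst_le (x - equilibrium lam ε), ?_,
    (norm_snd_le (x - equilibrium lam ε).2).trans (norm_snd_le (x - equilibrium lam ε))⟩
  have h := (norm_fst_le (x - equilibrium lam ε).2).trans (norm_snd_le (x - equilibrium lam ε))
  rwa [show (x - equilibrium lam ε).2.1 = x.2.1 from sub_zero _] at h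

theorem norm_sub_equilibrium_sq_le (x : State) :
    ‖x - equilibrium lam ε‖ ^ 2 ≤
      ‖x.1 - qbar‖ ^ 2 + ‖x.2.1‖ ^ 2 + ‖x.2.2 - (1 / (ε * lam)) • qbar‖ ^ 2 := by
  have h : ‖x - equilibrium lam ε‖ =
      max ‖x.1 - qbar‖ (max ‖x.2.1‖ ‖x.2.2 - (1 / (ε * lam)) • qbar‖) := by
    rw [Prod.norm_def, Prod.norm_def, show (x - equilibrium lam ε).2.1 = x.2.1 from sub_zero _]
    rfl
  have h1 := sq_nonneg ‖x.1 - qbar‖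
  have h2 := sq_nonneg ‖x.2.1‖
  have h3 := sq_nonneg ‖x.2.2 - (1 / (ε * lam)) • qbar‖
  rw [h]
  rcases max_choice ‖x.1 - qbar‖ (max ‖x.2.1‖ ‖x.2.2 - (1 / (ε * lam)) • qbar‖) with h | h <;>
    rw [h]
  · linarith
  · rcases max_choice ‖x.2.1‖ ‖x.2.2 - (1 / (ε * lam)) • qbar‖ with h | h <;> rw [h] <;> linarith

theorem vecCLM_filter_sub (x : State) :
    vecCLM (x.2.2 - (1 / (ε * lam)) • qbar) = vecCLM x.2.2 := by
  rw [map_sub, map_smul, vecCLM_qbar, smul_zero, sub_zero]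

theorem scalar_filter_sub (x : State) :
    (x.2.2 - (1 / (ε * lam)) • qbar) 3 = scalCoord lam ε x := by
  simp [scalCoord, qbar]

theorem norm_feedback_le (hk : 0 < k) (hc : 0 < c) (x : State) :
    ‖feedback k c lam ε x‖ ≤ k * ‖attCoord x‖ + c * ‖filtCoord lam ε x‖ := by
  refine (norm_add_le _ _).trans_eq ?_
  rw [norm_smul_of_nonneg hk.le, norm_smul_of_nonneg hc.le]

theorem abs_scalCoord_le (x : State) : |scalCoord lam ε x| ≤ ‖x - equilibrium lam ε‖ := by
  rw [← scalar_filter_sub]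
  exact (abs_apply_three_le _).trans (norm_sub_equilibrium_components x).2.2

/-- The Lyapunov coordinates are bounded by the distance to the equilibrium. -/
theorem exists_tripleNorm_le (J : Matrix (Fin 3) (Fin 3) ℝ)
    (hM : ∀ t, ‖H t‖ ≤ M) (hk : 0 < k) (hc : 0 < c) (hε : 0 < ε) (hlam : 0 < lam) :
    ∃ C > 0, ∀ t x,
      tripleNorm (attCoord x) (avgMom J H k c lam ε t x) (filtCoord lam ε x) ≤
          C * ‖x - equilibrium lam ε‖ := by
  have hM0 : 0 ≤ M := (norm_nonneg _).trans (hM 0)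
  refine ⟨1 + (1 / ε * ‖Matrix.toEuclideanCLM (𝕜 := ℝ) J‖ + ε * (M * (k + c * (1 + ε * lam))))
    + (1 + ε * lam), by positivity, fun t x => ?_⟩
  obtain ⟨hq, hω, hδ⟩ := norm_sub_equilibrium_components (lam := lam) (ε := ε) x
  set D := ‖x - equilibrium lam ε‖
  have hD0 : 0 ≤ D := norm_nonneg _
  have hp : ‖attCoord x‖ ≤ D := by
    have := norm_vecCLM_le (x.1 - qbar)
    rw [map_sub, vecCLM_qbar, sub_zero] at this
    exact this.trans hq
  have hδn : ‖vecCLM x.2.2‖ ≤ D := by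
    rw [← vecCLM_filter_sub]; exact (norm_vecCLM_le _).trans hδ
  have hs : ‖filtCoord lam ε x‖ ≤ (1 + ε * lam) * D := by
    rw [filtCoord, map_sub, map_smul]
    refine (norm_sub_le _ _).trans ?_
    rw [norm_smul_of_nonneg (by positivity)]
    have hp' : ‖vecCLM x.1‖ ≤ D := hp
    linarith [mul_le_mul_of_nonneg_left hδn (mul_pos hε hlam).le]
  have hfb : ‖feedback k c lam ε x‖ ≤ (k + c * (1 + ε * lam)) * D := by
    refine (norm_feedback_le hk hc x).trans ?_
    linarith [mul_le_mul_of_nonneg_left hp hk.le, mul_le_mul_of_nonneg_left hs hc.le]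
  have hh : ‖avgMom J H k c lam ε t x‖ ≤
      (1 / ε * ‖Matrix.toEuclideanCLM (𝕜 := ℝ) J‖ + ε * (M * (k + c * (1 + ε * lam)))) * D := by
    refine (norm_add_le _ _).trans ?_
    rw [momCoord, norm_smul_of_nonneg (by positivity), norm_smul_of_nonneg hε.le, add_mul]
    have h1 : ‖Matrix.toEuclideanCLM (𝕜 := ℝ) J x.2.1‖ ≤
        ‖Matrix.toEuclideanCLM (𝕜 := ℝ) J‖ * D :=
      (ContinuousLinearMap.le_opNorm _ _).trans (mul_le_mul_of_nonneg_left hω (norm_nonneg _))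
    have h2 := ((H t).le_of_opNorm_le (hM t) _).trans (mul_le_mul_of_nonneg_left hfb hM0)
    have h3 := mul_le_mul_of_nonneg_left h1 (one_div_pos.2 hε).le
    have h4 := mul_le_mul_of_nonneg_left h2 hε.le
    linarith
  rw [tripleNorm]
  linarith

/-- The distance to the equilibrium is bounded by the Lyapunov coordinates. -/
theorem exists_norm_sub_equilibrium_le {Jmin Jmax : ℝ} (hJmin : 0 < Jmin)
    (hJ : AdmissibleInertia Jmin Jmax J)
    (hM : ∀ t, ‖H t‖ ≤ M) (hk : 0 < k) (hc : 0 < c) (hε : 0 < ε) (hlam : 0 < lam) :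
    ∃ C > 0, ∀ t, ∀ x ∈ stateSpace, ‖x - equilibrium lam ε‖ ≤ 1 →
      ‖x - equilibrium lam ε‖ ^ 2 ≤ C * (tripleSq (attCoord x) (avgMom J H k c lam ε t x)
        (filtCoord lam ε x) + scalCoord lam ε x ^ 2) := by
  have hM0 : 0 ≤ M := (norm_nonneg _).trans (hM 0)
  obtain ⟨L, hL⟩ : ∃ L, L = ε * (Jmin⁻¹ * (1 + ε * (M * (k + c)))) := ⟨_, rfl⟩
  -- The summands are the squared costs, relative to the sum norm of the triple, of q − q̄, of ω and
  -- of the vector part of δ.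
  obtain ⟨W, hW⟩ : ∃ W, W = 2 + (L ^ 2 + (1 / (ε * lam)) ^ 2) := ⟨_, rfl⟩
  have hW0 : 0 ≤ W := by rw [hW]; positivity
  refine ⟨1 + 3 * W, by positivity, fun t x hx hx1 => ?_⟩
  obtain ⟨hq, -, -⟩ := norm_sub_equilibrium_components (lam := lam) (ε := ε) x
  have hDle := norm_sub_equilibrium_sq_le (lam := lam) (ε := ε) x
  set n := tripleNorm (attCoord x) (avgMom J H k c lam ε t x) (filtCoord lam ε x) with hn
  have hn' : n = ‖attCoord x‖ + ‖avgMom J H k c lam ε t x‖ + ‖filtCoord lam ε x‖ := rfl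
  have hp0 := norm_nonneg (attCoord x)
  have hh0 := norm_nonneg (avgMom J H k c lam ε t x)
  have hs0 := norm_nonneg (filtCoord lam ε x)
  have hfbn : ‖feedback k c lam ε x‖ ≤ (k + c) * n := by
    refine (norm_feedback_le hk hc x).trans ?_
    rw [add_mul]
    gcongr <;> linarith
  have hmom : ‖momCoord J ε x‖ ≤ (1 + ε * (M * (k + c))) * n := by
    have : momCoord J ε x = avgMom J H k c lam ε t x - ε • H t (feedback k c lam ε x) := by
      rw [avgMom, add_sub_cancel_right]
    rw [this]
    refine (norm_sub_le _ _).trans ?_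
    rw [norm_smul_of_nonneg hε.le]
    have h2 := ((H t).le_of_opNorm_le (hM t) _).trans (mul_le_mul_of_nonneg_left hfbn hM0)
    linarith [mul_le_mul_of_nonneg_left h2 hε.le]
  have hωn : ‖x.2.1‖ ≤ L * n := by
    have h1 : x.2.1 = ε • Matrix.toEuclideanCLM (𝕜 := ℝ) J⁻¹ (momCoord J ε x) := by
      rw [momCoord, map_smul, (hJ.toEuclideanCLM_inv_apply hJmin x.2.1).1, smul_smul,
        mul_one_div_cancel hε.ne', one_smul]
    rw [h1, norm_smul_of_nonneg hε.le, hL]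
    have h2 := (hJ.norm_inv_le hJmin (momCoord J ε x)).trans
      (mul_le_mul_of_nonneg_left hmom (inv_pos.2 hJmin).le)
    linarith [mul_le_mul_of_nonneg_left h2 hε.le]
  have hδn' : ‖vecCLM x.2.2‖ ≤ 1 / (ε * lam) * n := by
    have h1 : vecCLM x.2.2 = (1 / (ε * lam)) • (attCoord x - filtCoord lam ε x) := by
      rw [attCoord, filtCoord, map_sub, map_smul, sub_sub_cancel, smul_smul,
        one_div_mul_cancel (by positivity), one_smul]
    rw [h1, norm_smul_of_nonneg (by positivity)]
    exact mul_le_mul_of_nonneg_left ((norm_sub_le _ _).trans (by linarith)) (by positivity)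
  have e1 := norm_attitude_sub_sq_le hx (hq.trans hx1)
  have e2 : ‖x.2.1‖ ^ 2 ≤ L ^ 2 * n ^ 2 := by
    rw [← mul_pow]; exact pow_le_pow_left₀ (norm_nonneg _) hωn 2
  have e3 : ‖x.2.2 - (1 / (ε * lam)) • qbar‖ ^ 2 ≤
      (1 / (ε * lam)) ^ 2 * n ^ 2 + scalCoord lam ε x ^ 2 := by
    rw [norm_sq_eq_vecCLM, vecCLM_filter_sub, scalar_filter_sub, ← mul_pow]
    gcongr
  have e4 : ‖attCoord x‖ ^ 2 ≤ n ^ 2 := pow_le_pow_left₀ hp0 (by linarith) 2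
  have e5 := mul_le_mul_of_nonneg_left
    (sq_tripleNorm_le (attCoord x) (avgMom J H k c lam ε t x) (filtCoord lam ε x)) hW0
  rw [← hn] at e5
  have hT : 0 ≤ tripleSq (attCoord x) (avgMom J H k c lam ε t x) (filtCoord lam ε x) := by
    unfold tripleSq; positivity
  have e6 : W * n ^ 2 = 2 * n ^ 2 + L ^ 2 * n ^ 2 + (1 / (ε * lam)) ^ 2 * n ^ 2 := by
    rw [hW]; ring
  have e7 := mul_nonneg hW0 (sq_nonneg (scalCoord lam ε x))
  linarith

end Comparison

/-! ### Assembly: Lyapunov function and exponential stability of the closed loop. -/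

section Stability

variable {J : Matrix (Fin 3) (Fin 3) ℝ} {Γ : ℝ → Matrix (Fin 3) (Fin 3) ℝ}
  {Γav : Matrix (Fin 3) (Fin 3) ℝ}
  {H : ℝ → EuclideanSpace ℝ (Fin 3) →L[ℝ] EuclideanSpace ℝ (Fin 3)}
  {κ k₁ k₂ α lam ε : ℝ}

/-- The time-varying Lyapunov function of the closed loop. -/
def closedLoopLyap (J Γav : Matrix (Fin 3) (Fin 3) ℝ)
    (H : ℝ → EuclideanSpace ℝ (Fin 3) →L[ℝ] EuclideanSpace ℝ (Fin 3))
    (κ k₁ c lam ε t : ℝ) (x : State) : ℝ :=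
  lyapFun κ k₁ c (Matrix.toEuclideanCLM (𝕜 := ℝ) J⁻¹) (Matrix.toEuclideanCLM (𝕜 := ℝ) Γav)
    (attCoord x) (avgMom J H k₁ c lam ε t x) (filtCoord lam ε x) + scalCoord lam ε x ^ 2

/-- The derivative of `closedLoopLyap` along the vector field with value `v` at the state `x`, when
`H` has the derivative `H'`. -/
def closedLoopLyapDeriv (J Γav : Matrix (Fin 3) (Fin 3) ℝ)
    (H H' : ℝ → EuclideanSpace ℝ (Fin 3) →L[ℝ] EuclideanSpace ℝ (Fin 3))
    (κ k₁ c lam ε t : ℝ) (x v : State) : ℝ :=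
  lyapDeriv κ k₁ c (Matrix.toEuclideanCLM (𝕜 := ℝ) J⁻¹) (Matrix.toEuclideanCLM (𝕜 := ℝ) Γav)
    (attCoord x) (avgMom J H k₁ c lam ε t x) (filtCoord lam ε x) (attCoord v)
    (momCoord J ε v + ε • (H' t (feedback k₁ c lam ε x) + H t (feedback k₁ c lam ε v)))
    (filtCoord lam ε v) + 2 * scalCoord lam ε x * v.2.2 3

theorem hasDerivWithinAt_closedLoopLyap {c : ℝ}
    (hK : ∀ x y, inner ℝ x (Matrix.toEuclideanCLM (𝕜 := ℝ) J⁻¹ y) =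
      inner ℝ y (Matrix.toEuclideanCLM (𝕜 := ℝ) J⁻¹ x))
    (hG : ∀ x y, inner ℝ x (Matrix.toEuclideanCLM (𝕜 := ℝ) Γav y) =
      inner ℝ y (Matrix.toEuclideanCLM (𝕜 := ℝ) Γav x))
    {H' : ℝ → EuclideanSpace ℝ (Fin 3) →L[ℝ] EuclideanSpace ℝ (Fin 3)}
    (hH : ∀ t, HasDerivAt H (H' t) t) {γ : ℝ → State} {v : State} {I : Set ℝ} {t : ℝ}
    (hγ : HasDerivWithinAt γ v I t) :
    HasDerivWithinAt (fun u => closedLoopLyap J Γav H κ k₁ c lam ε u (γ u))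
      (closedLoopLyapDeriv J Γav H H' κ k₁ c lam ε t (γ t) v) I t := by
  have h1 : HasDerivWithinAt (fun u => (γ u).1) v.1 I t :=
    (ContinuousLinearMap.fst ℝ (EuclideanSpace ℝ (Fin 4)) (EuclideanSpace ℝ (Fin 3) × EuclideanSpace ℝ (Fin 4))).hasFDerivAt.comp_hasDerivWithinAt
      t hγ
  have h23 : HasDerivWithinAt (fun u => (γ u).2) v.2 I t :=
    (ContinuousLinearMap.snd ℝ (EuclideanSpace ℝ (Fin 4)) (EuclideanSpace ℝ (Fin 3) × EuclideanSpace ℝ (Fin 4))).hasFDerivAt.comp_hasDerivWithinAt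
      t hγ
  have h2 : HasDerivWithinAt (fun u => (γ u).2.1) v.2.1 I t :=
    (ContinuousLinearMap.fst ℝ (EuclideanSpace ℝ (Fin 3)) (EuclideanSpace ℝ (Fin 4))).hasFDerivAt.comp_hasDerivWithinAt
      t h23
  have h3 : HasDerivWithinAt (fun u => (γ u).2.2) v.2.2 I t :=
    (ContinuousLinearMap.snd ℝ (EuclideanSpace ℝ (Fin 3)) (EuclideanSpace ℝ (Fin 4))).hasFDerivAt.comp_hasDerivWithinAt
      t h23
  have hp : HasDerivWithinAt (fun u => attCoord (γ u)) (attCoord v) I t :=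
    vecCLM.hasFDerivAt.comp_hasDerivWithinAt t h1
  have hh : HasDerivWithinAt (fun u => momCoord J ε (γ u)) (momCoord J ε v) I t :=
    ((Matrix.toEuclideanCLM (𝕜 := ℝ) J).hasFDerivAt.comp_hasDerivWithinAt t h2).const_smul (1 / ε)
  have hs : HasDerivWithinAt (fun u => filtCoord lam ε (γ u)) (filtCoord lam ε v) I t :=
    vecCLM.hasFDerivAt.comp_hasDerivWithinAt t (h1.sub (h3.const_smul (ε * lam)))
  have hy : HasDerivWithinAt (fun u => feedback k₁ c lam ε (γ u)) (feedback k₁ c lam ε v) I t :=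
    (hp.const_smul k₁).add (hs.const_smul c)
  have he : HasDerivWithinAt (fun u => scalCoord lam ε (γ u)) (v.2.2 3) I t :=
    ((EuclideanSpace.proj (𝕜 := ℝ) (3 : Fin 4)).hasFDerivAt.comp_hasDerivWithinAt t h3).sub_const _
  have hHy := (hH t).hasDerivWithinAt (s := I) |>.clm_apply hy
  have := (hasDerivWithinAt_lyapFun (κ := κ) (k := k₁) (c := c) hK hG hp
    (hh.add (hHy.const_smul ε)) hs).add (he.pow 2)
  convert! this using 1
  rw [closedLoopLyapDeriv]
  simp [avgMom]

/-- The only member of `⊤` is the whole time axis, so the radius does not depend on t. -/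
theorem exists_radius_of_isLittleO {F : ℝ × State → EuclideanSpace ℝ (Fin 3)} {xe : State}
    (hF : F =o[⊤ ×ˢ 𝓝 xe] fun z => z.2 - xe) {η : ℝ} (hη : 0 < η) :
    ∃ ρ > 0, ∀ t x, ‖x - xe‖ < ρ → ‖F (t, x)‖ ≤ η * ‖x - xe‖ := by
  obtain ⟨s, hs, u, hu, hsu⟩ := mem_prod_iff.1 (hF.def hη)
  obtain ⟨ρ, hρ, hball⟩ := Metric.mem_nhds_iff.1 hu
  refine ⟨ρ, hρ, fun t x hx => hsu ⟨?_, hball (mem_ball_iff_norm.2 hx)⟩⟩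
  rw [mem_top.1 hs]
  trivial

theorem closedLoop_equilibrium (hε : ε ≠ 0) (hlam : lam ≠ 0) (t : ℝ) :
    closedLoop J Γ k₁ k₂ α lam ε t (equilibrium lam ε) = 0 := by
  have h2 : (qbar : Fin 4 → ℝ) -
      (ε * lam) • (((1 / (ε * lam)) • qbar : EuclideanSpace ℝ (Fin 4)) : Fin 4 → ℝ) = 0 := by
    rw [WithLp.ofLp_smul, smul_smul, mul_one_div_cancel (mul_ne_zero hε hlam), one_smul, sub_self]
  simp only [closedLoop, equilibrium, controlLaw_equilibrium hε hlam, h2]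
  simp

theorem closedLoopLyap_bounds {a C C₁ C₂ c : ℝ} (ha : 0 < a) (hC : 0 < C) (hC₂ : 0 < C₂)
    (hlow : ∀ p h s : EuclideanSpace ℝ (Fin 3), a * tripleSq p h s ≤ lyapFun κ k₁ c
      (Matrix.toEuclideanCLM (𝕜 := ℝ) J⁻¹) (Matrix.toEuclideanCLM (𝕜 := ℝ) Γav) p h s)
    (hup : ∀ p h s : EuclideanSpace ℝ (Fin 3), lyapFun κ k₁ c
      (Matrix.toEuclideanCLM (𝕜 := ℝ) J⁻¹) (Matrix.toEuclideanCLM (𝕜 := ℝ) Γav) p h s ≤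
        C * tripleNorm p h s ^ 2) {t : ℝ} {x : State}
    (h1 : tripleNorm (attCoord x) (avgMom J H k₁ c lam ε t x) (filtCoord lam ε x) ≤
      C₁ * ‖x - equilibrium lam ε‖)
    (h2 : ‖x - equilibrium lam ε‖ ^ 2 ≤ C₂ * (tripleSq (attCoord x)
      (avgMom J H k₁ c lam ε t x) (filtCoord lam ε x) + scalCoord lam ε x ^ 2)) :
    min a 1 / C₂ * ‖x - equilibrium lam ε‖ ^ 2 ≤ closedLoopLyap J Γav H κ k₁ c lam ε t x ∧
      closedLoopLyap J Γav H κ k₁ c lam ε t x ≤ (C * C₁ ^ 2 + 1) * ‖x - equilibrium lam ε‖ ^ 2 := by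
  have hmin : 0 < min a 1 := lt_min ha one_pos
  have hs := abs_scalCoord_le (lam := lam) (ε := ε) x
  have hs2 : scalCoord lam ε x ^ 2 ≤ ‖x - equilibrium lam ε‖ ^ 2 := by
    rw [← sq_abs]; exact pow_le_pow_left₀ (abs_nonneg _) hs 2
  have hl := hlow (attCoord x) (avgMom J H k₁ c lam ε t x) (filtCoord lam ε x)
  have hu := hup (attCoord x) (avgMom J H k₁ c lam ε t x) (filtCoord lam ε x)
  have hn := pow_le_pow_left₀ (tripleNorm_nonneg _ _ _) h1 2
  rw [closedLoopLyap]
  set T := tripleSq (attCoord x) (avgMom J H k₁ c lam ε t x) (filtCoord lam ε x) with hT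
  have hT0 : 0 ≤ T := by rw [hT, tripleSq]; positivity
  constructor
  · calc min a 1 / C₂ * ‖x - equilibrium lam ε‖ ^ 2
        ≤ min a 1 / C₂ * (C₂ * (T + scalCoord lam ε x ^ 2)) := by gcongr
      _ = min a 1 * T + min a 1 * scalCoord lam ε x ^ 2 := by field_simp
      _ ≤ a * T + 1 * scalCoord lam ε x ^ 2 := by
          gcongr
          · exact min_le_left _ _
          · exact min_le_right _ _
      _ ≤ _ := by linarith
  · have := mul_le_mul_of_nonneg_left hn hC.le
    rw [mul_pow] at this
    linarith

/-- Of the decay (μ/C₂)D², where D is the distance, the choice of η gives up a quarter to the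
remainders and the choice of ρ a quarter to the term e·(q₄ − 1), which is cubic in D. Half is left.
-/
theorem closedLoopLyapDeriv_le {Jmin Jmax M C m C₁ C₂ η ρ μ : ℝ} (hJmin : 0 < Jmin)
    (hJ : AdmissibleInertia Jmin Jmax J) (hε : 0 < ε) (hlam : 0 < lam) (hα : 0 < α) (hC : 0 < C)
    (hC₁ : 0 < C₁) (hμ0 : 0 < μ) (hC₂ : 0 < C₂)
    (hdecay : ∀ (p h s : EuclideanSpace ℝ (Fin 3))
      (H : EuclideanSpace ℝ (Fin 3) →L[ℝ] EuclideanSpace ℝ (Fin 3))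
      (rp rh p' h' s' z : EuclideanSpace ℝ (Fin 3)), (∀ x, ‖H x‖ ≤ M * ‖x‖) →
      z = h - ε • H (k₁ • p + (k₂ * α * lam / 2) • s) →
      p' = ε • ((1 / 2 : ℝ) • Matrix.toEuclideanCLM (𝕜 := ℝ) J⁻¹ z) + rp →
      s' = ε • ((1 / 2 : ℝ) • Matrix.toEuclideanCLM (𝕜 := ℝ) J⁻¹ z - (α * lam) • s) + rp →
      h' = -(ε • Matrix.toEuclideanCLM (𝕜 := ℝ) Γav (k₁ • p + (k₂ * α * lam / 2) • s)) + rh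
        + ε • H (k₁ • p' + (k₂ * α * lam / 2) • s') →
      lyapDeriv κ k₁ (k₂ * α * lam / 2) (Matrix.toEuclideanCLM (𝕜 := ℝ) J⁻¹)
          (Matrix.toEuclideanCLM (𝕜 := ℝ) Γav) p h s p' h' s' ≤
        -(ε * m) * tripleSq p h s + C * tripleNorm p h s * (‖rp‖ + ‖rh‖))
    (hμ : μ ≤ ε * m) (hμ' : μ ≤ 2 * (ε * (α * lam)))
    (hη : 8 * (C * C₁ * C₂) * η ≤ μ) (hρ : 4 * (α * C₂) * ρ ≤ μ) {t : ℝ} (hH : ‖H t‖ ≤ M) {x : State}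
    (hx : x ∈ stateSpace) (hxρ : ‖x - equilibrium lam ε‖ < ρ)
    (hrp : ‖attitudeRem x‖ ≤ η * ‖x - equilibrium lam ε‖)
    (hrh : ‖momentumRem J Γ k₁ k₂ α lam ε t x‖ ≤ η * ‖x - equilibrium lam ε‖)
    (h1 : tripleNorm (attCoord x) (avgMom J H k₁ (k₂ * α * lam / 2) lam ε t x)
      (filtCoord lam ε x) ≤ C₁ * ‖x - equilibrium lam ε‖)
    (h2 : ‖x - equilibrium lam ε‖ ^ 2 ≤ C₂ * (tripleSq (attCoord x)
      (avgMom J H k₁ (k₂ * α * lam / 2) lam ε t x) (filtCoord lam ε x) + scalCoord lam ε x ^ 2)) :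
    closedLoopLyapDeriv J Γav H (fun t => Matrix.toEuclideanCLM (𝕜 := ℝ) (Γ t) -
        Matrix.toEuclideanCLM (𝕜 := ℝ) Γav) κ k₁ (k₂ * α * lam / 2) lam ε t x
        (closedLoop J Γ k₁ k₂ α lam ε t x) ≤
      -(μ / (2 * C₂)) * ‖x - equilibrium lam ε‖ ^ 2 := by
  have hfst := vecCLM_closedLoop_fst (Γ := Γ) (k₁ := k₁) (k₂ := k₂) (α := α) (lam := lam)
    hJmin hJ hε.ne' t x
  have hmom := toEuclideanCLM_closedLoop_momentum (Γ := Γ) (k₁ := k₁) (k₂ := k₂) (α := α)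
    (lam := lam) hJmin hJ hε.ne' t x
  have hfilt := vecCLM_closedLoop_filter (J := J) (Γ := Γ) (k₁ := k₁) (k₂ := k₂) (α := α)
    (lam := lam) (ε := ε) t x
  have hscal := closedLoop_scalar (J := J) (Γ := Γ) (k₁ := k₁) (k₂ := k₂) (α := α) hε.ne'
    hlam.ne' t x
  set f := closedLoop J Γ k₁ k₂ α lam ε t x with hf
  set c := k₂ * α * lam / 2 with hc
  have hz : momCoord J ε x = avgMom J H k₁ c lam ε t x -
      ε • H t (k₁ • attCoord x + c • filtCoord lam ε x) := by
    rw [avgMom, feedback, add_sub_cancel_right]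
  have hs' : filtCoord lam ε f = ε • ((1 / 2 : ℝ) • Matrix.toEuclideanCLM (𝕜 := ℝ) J⁻¹
      (momCoord J ε x) - (α * lam) • filtCoord lam ε x) + attitudeRem x := by
    rw [filtCoord, map_sub, map_smul, hfst, hfilt]
    module
  -- The derivative of `H` contributes ε(Γ(t) − Γav), which turns −εΓ(t) into −εΓav: this
  -- cancellation is the purpose of the averaging coordinate.
  have hh' : momCoord J ε f + ε • ((Matrix.toEuclideanCLM (𝕜 := ℝ) (Γ t) -
      Matrix.toEuclideanCLM (𝕜 := ℝ) Γav) (feedback k₁ c lam ε x)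
        + H t (feedback k₁ c lam ε f)) =
      -(ε • Matrix.toEuclideanCLM (𝕜 := ℝ) Γav (k₁ • attCoord x + c • filtCoord lam ε x))
        + momentumRem J Γ k₁ k₂ α lam ε t x
        + ε • H t (k₁ • attCoord f + c • filtCoord lam ε f) := by
    rw [momCoord, hmom, sub_apply]
    simp only [feedback]
    module
  have hd := hdecay (attCoord x) (avgMom J H k₁ c lam ε t x) (filtCoord lam ε x) (H t)
    (attitudeRem x) (momentumRem J Γ k₁ k₂ α lam ε t x) (attCoord f) _ (filtCoord lam ε f)
    (momCoord J ε x) (fun y => (H t).le_of_opNorm_le hH y) hz hfst hs' hh'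
  rw [closedLoopLyapDeriv, hscal, one_sub_scalar_eq hx]
  set T := tripleSq (attCoord x) (avgMom J H k₁ c lam ε t x) (filtCoord lam ε x) with hT
  set n := tripleNorm (attCoord x) (avgMom J H k₁ c lam ε t x) (filtCoord lam ε x) with hn
  have hT0 : 0 ≤ T := by rw [hT, tripleSq]; positivity
  have hn0 : 0 ≤ n := tripleNorm_nonneg _ _ _
  have hq := (norm_sub_equilibrium_components (lam := lam) (ε := ε) x).1
  have he := abs_scalCoord_le (lam := lam) (ε := ε) x
  set D := ‖x - equilibrium lam ε‖
  have hD0 : 0 ≤ D := norm_nonneg _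
  set e := scalCoord lam ε x
  have b1 : C * n * (‖attitudeRem x‖ + ‖momentumRem J Γ k₁ k₂ α lam ε t x‖) ≤
      μ / (4 * C₂) * D ^ 2 := by
    calc C * n * (‖attitudeRem x‖ + ‖momentumRem J Γ k₁ k₂ α lam ε t x‖)
        ≤ C * (C₁ * D) * (η * D + η * D) := by gcongr
      _ = (8 * (C * C₁ * C₂) * η) / (4 * C₂) * D ^ 2 := by field_simp; ring
      _ ≤ μ / (4 * C₂) * D ^ 2 := by gcongr
  have b2 : 2 * e * (α * -(‖x.1 - qbar‖ ^ 2 / 2)) ≤ μ / (4 * C₂) * D ^ 2 := by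
    calc 2 * e * (α * -(‖x.1 - qbar‖ ^ 2 / 2)) = α * (-e * ‖x.1 - qbar‖ ^ 2) := by ring
      _ ≤ α * (ρ * D ^ 2) := by
          gcongr
          · exact hD0.trans hxρ.le
          · exact (neg_le_abs e).trans (he.trans hxρ.le)
      _ = (4 * (α * C₂) * ρ) / (4 * C₂) * D ^ 2 := by field_simp
      _ ≤ μ / (4 * C₂) * D ^ 2 := by gcongr
  have b3 : μ / C₂ * D ^ 2 ≤ μ * (T + e ^ 2) := by
    calc μ / C₂ * D ^ 2 ≤ μ / C₂ * (C₂ * (T + e ^ 2)) := by gcongr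
      _ = μ * (T + e ^ 2) := by field_simp
  have b4 := mul_le_mul_of_nonneg_right hμ hT0
  have b5 := mul_le_mul_of_nonneg_right hμ' (sq_nonneg e)
  have b6 : μ / (2 * C₂) * D ^ 2 = μ / C₂ * D ^ 2 - μ / (4 * C₂) * D ^ 2 - μ / (4 * C₂) * D ^ 2 := by
    field_simp
    ring
  linarith

/-- The order of choices matters: `κ`, `m`, `C` and `ε₀` precede ε and J, whereas the comparison
constants, η, ρ and the decay rate are chosen after them. -/
theorem isLocallyExpStable_closedLoop {Jmin Jmax : ℝ} (hJmin : 0 < Jmin) (hJle : Jmin ≤ Jmax)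
    (hk₁ : 0 < k₁) (hk₂ : 0 < k₂) (hα : 0 < α) (hlam : 0 < lam)
    (hΓc : ∀ i j, Continuous fun t => Γ t i j) (hΓb : ∀ i j, ∃ M, ∀ t, |Γ t i j| ≤ M)
    (hav : ∀ i j, ∃ M, ∀ T, |∫ τ in (0 : ℝ)..T, (Γ τ i j - Γav i j)| ≤ M) (hpos : Γav.PosDef) :
    ∃ εstar : ℝ, 0 < εstar ∧ ∀ ε : ℝ, 0 < ε → ε < εstar →
      ∀ J : Matrix (Fin 3) (Fin 3) ℝ, AdmissibleInertia Jmin Jmax J →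
        IsLocallyExpStable (closedLoop J Γ k₁ k₂ α lam ε) stateSpace (equilibrium lam ε) := by
  obtain ⟨M, H, hM0, hM, hH⟩ := exists_bounded_primitive hΓc hav
  obtain ⟨g, hg, hgle⟩ := exists_le_inner_of_posDef hpos
  have hGs := inner_toEuclideanCLM_symm hpos.1
  have hJmax : 0 < Jmax := hJmin.trans_le hJle
  have hc : 0 < k₂ * α * lam / 2 := by positivity
  obtain ⟨κ, a, m, C, ε₀, ha, hm, hC, hε₀, hlyap⟩ :=
    exists_lyapFun_bounds_perturbed (EuclideanSpace ℝ (Fin 3)) hg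
      (norm_nonneg (Matrix.toEuclideanCLM (𝕜 := ℝ) Γav)) (inv_pos.2 hJmax) (inv_pos.2 hJmin).le
      hk₁ hc (mul_pos hα hlam) hM0
  refine ⟨ε₀, hε₀, fun ε hε hεlt J hJ => ?_⟩
  have hb := hlyap ε hε hεlt (Matrix.toEuclideanCLM (𝕜 := ℝ) J⁻¹)
    (Matrix.toEuclideanCLM (𝕜 := ℝ) Γav) hGs hgle (ContinuousLinearMap.le_opNorm _)
    (hJ.le_inner_inv hJmin) (hJ.norm_inv_le hJmin)
  obtain ⟨C₁, hC₁, hcmp₁⟩ := exists_tripleNorm_le (H := H) J hM hk₁ hc hε hlam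
  obtain ⟨C₂, hC₂, hcmp₂⟩ := exists_norm_sub_equilibrium_le (H := H) hJmin hJ hM hk₁ hc hε hlam
  obtain ⟨μ, hμ0, hμ, hμ'⟩ : ∃ μ > 0, μ ≤ ε * m ∧ μ ≤ 2 * (ε * (α * lam)) :=
    ⟨min (ε * m) (2 * (ε * (α * lam))), by positivity, min_le_left _ _, min_le_right _ _⟩
  obtain ⟨η, hη0, hη⟩ : ∃ η > 0, 8 * (C * C₁ * C₂) * η ≤ μ :=
    ⟨μ / (8 * (C * C₁ * C₂)), by positivity, (mul_div_cancel₀ _ (by positivity)).le⟩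
  obtain ⟨ρ₁, hρ₁, hrp⟩ := exists_radius_of_isLittleO (isLittleO_attitudeRem lam ε) hη0
  obtain ⟨ρ₂, hρ₂, hrh⟩ := exists_radius_of_isLittleO
    (isLittleO_momentumRem J hΓb k₁ k₂ α hε.ne' hlam.ne') hη0
  set ρ := min (min ρ₁ ρ₂) (min 1 (μ / (4 * (α * C₂)))) with hρdef
  have hρ0 : 0 < ρ := by positivity
  have hρ₁' : ρ ≤ ρ₁ := (min_le_left _ _).trans (min_le_left _ _)
  have hρ₂' : ρ ≤ ρ₂ := (min_le_left _ _).trans (min_le_right _ _)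
  have hρ1 : ρ ≤ 1 := (min_le_right _ _).trans (min_le_left _ _)
  have hρμ : 4 * (α * C₂) * ρ ≤ μ := by
    rw [← le_div_iff₀' (by positivity)]
    exact (min_le_right _ _).trans (min_le_right _ _)
  choose B hB using hΓb
  have hVb : ∀ t, ∀ x ∈ stateSpace, ‖x - equilibrium lam ε‖ < ρ → _ := fun t x hx hlt =>
    closedLoopLyap_bounds (J := J) (Γav := Γav) (H := H) (t := t) ha hC hC₂
      (fun p h s => (hb p h s).1) (fun p h s => (hb p h s).2.1) (hcmp₁ t x)
      (hcmp₂ t x hx (hlt.le.trans hρ1))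
  refine isLocallyExpStable_of_lyapunov (P := Fin 3 → Fin 3 → ℝ)
    (F := fun z => closedLoop J (fun _ => Matrix.of z.1) k₁ k₂ α lam ε 0 z.2)
    (contDiff_closedLoop J k₁ k₂ α lam ε) (Γ := fun t i j => Γ t i j)
    (continuous_pi fun i => continuous_pi fun j => hΓc i j) (M := ∑ i, ∑ j, |B i j|) (fun t => ?_)
    (f := closedLoop J Γ k₁ k₂ α lam ε) (fun t x => rfl) (φ := fun x => ‖x.1‖ ^ 2)
    (φ' := fun x => (2 • innerSL ℝ x.1).comp (ContinuousLinearMap.fst ℝ _ _)) (fun x => ?_)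
    (fun t x => ?_) (φ₀ := 1) ?_ ?_ (closedLoop_equilibrium hε.ne' hlam.ne')
    (V := closedLoopLyap J Γav H κ k₁ (k₂ * α * lam / 2) lam ε)
    (V' := fun t x => closedLoopLyapDeriv J Γav H (fun t => Matrix.toEuclideanCLM (𝕜 := ℝ) (Γ t) -
        Matrix.toEuclideanCLM (𝕜 := ℝ) Γav) κ k₁ (k₂ * α * lam / 2) lam ε t x
        (closedLoop J Γ k₁ k₂ α lam ε t x))
    -- 2r is the decay coefficient μ/(2C₂) of the squared distance divided by the upper comparison
    -- constant `b`.
    (a := min a 1 / C₂) (b := C * C₁ ^ 2 + 1) (r := μ / (2 * C₂) / (2 * (C * C₁ ^ 2 + 1)))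
    (by positivity) (by positivity) hρ0 hVb ?_ ?_
  · have hBle (i j : Fin 3) : |B i j| ≤ ∑ i, ∑ j, |B i j| :=
      (Finset.single_le_sum (f := fun j => |B i j|) (fun _ _ => abs_nonneg _)
        (Finset.mem_univ j)).trans (Finset.single_le_sum (f := fun i => ∑ j, |B i j|)
          (fun _ _ => Finset.sum_nonneg fun _ _ => abs_nonneg _) (Finset.mem_univ i))
    have h0 : 0 ≤ ∑ i, ∑ j, |B i j| := (abs_nonneg _).trans (hBle 0 0)
    exact (pi_norm_le_iff_of_nonneg h0).2 fun i => (pi_norm_le_iff_of_nonneg h0).2 fun j =>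
      (hB i j t).trans ((le_abs_self _).trans (hBle i j))
  · exact (hasStrictFDerivAt_norm_sq x.1).hasFDerivAt.comp x hasFDerivAt_fst
  · have h := dotProduct_kinMatrix_mulVec x.1 x.2.1
    have h' : inner ℝ x.1 (closedLoop J Γ k₁ k₂ α lam ε t x).1 = 0 := by
      rw [EuclideanSpace.inner_eq_star_dotProduct, dotProduct_comm]
      simpa [closedLoop] using h
    simp [h']
  · ext x
    change ‖x.1‖ = 1 ↔ ‖x.1‖ ^ 2 = 1
    rw [sq_eq_one_iff, or_iff_left (by linarith [norm_nonneg x.1])]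
  · simp [stateSpace, equilibrium, qbar, EuclideanSpace.norm_eq, Fin.sum_univ_four]
  · intro γ I t hγ
    exact hasDerivWithinAt_closedLoopLyap hJ.inner_inv_symm hGs hH hγ
  · intro t x hx hlt
    refine (closedLoopLyapDeriv_le hJmin hJ hε hlam hα hC hC₁ hμ0 hC₂
      (fun p h s => (hb p h s).2.2) hμ hμ' hη hρμ (hM t) hx hlt
      (hrp t x (hlt.trans_le hρ₁')) (hrh t x (hlt.trans_le hρ₂')) (hcmp₁ t x)
      (hcmp₂ t x hx (hlt.le.trans hρ1))).trans ?_
    have h1 := (hVb t x hx hlt).2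
    have h2 : μ / (2 * C₂) / (C * C₁ ^ 2 + 1) *
        closedLoopLyap J Γav H κ k₁ (k₂ * α * lam / 2) lam ε t x ≤
        μ / (2 * C₂) * ‖x - equilibrium lam ε‖ ^ 2 := by
      calc _ ≤ μ / (2 * C₂) / (C * C₁ ^ 2 + 1) *
            ((C * C₁ ^ 2 + 1) * ‖x - equilibrium lam ε‖ ^ 2) := by gcongr
        _ = _ := by field_simp
    have h3 : 2 * (μ / (2 * C₂) / (2 * (C * C₁ ^ 2 + 1))) =
        μ / (2 * C₂) / (C * C₁ ^ 2 + 1) := by field_simp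
    rw [h3]
    linarith

end Stability

end MagneticAttitude

end

open MagneticAttitude
theorem theorem2 (o : DipoleOrbit)
    (Jmin Jmax : ℝ) (hJmin : 0 < Jmin) (hJ : Jmin ≤ Jmax)
    (k₁ k₂ α lam : ℝ) (hk₁ : 0 < k₁) (hk₂ : 0 < k₂) (hα : 0 < α) (hlam : 0 < lam) :
    ∃ Γav : Matrix (Fin 3) (Fin 3) ℝ, HasTimeAverage o.Gamma Γav ∧
      (Γav.PosDef →
        ∃ εstar : ℝ, 0 < εstar ∧ ∀ ε : ℝ, 0 < ε → ε < εstar →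
          ∀ J : Matrix (Fin 3) (Fin 3) ℝ, AdmissibleInertia Jmin Jmax J →
            IsLocallyExpStable (closedLoop J o.Gamma k₁ k₂ α lam ε) stateSpace
              (qbar, 0, (1 / (ε * lam)) • qbar)) := by
  obtain ⟨Γav, hav, hb⟩ := o.exists_hasTimeAverage_Gamma
  exact ⟨Γav, hav, fun hpos => isLocallyExpStable_closedLoop hJmin hJ hk₁ hk₂ hα hlam
    (fun i j => continuous_of_mem_trigPoly (o.Gamma_mem_trigPoly i j))
    (fun i j => exists_bound_of_mem_trigPoly (o.Gamma_mem_trigPoly i j)) hb hpos⟩
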